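/- **Setting.** There are $M$ clients with probability distributions $\mathcal P_1,\dots,\mathcal P_M$ on a measurable space $\mathcal Z$. Client $m$ collects $N_m$ samples $z_m^{(1)},\dots,z_m^{(N_m)}$ over a horizon of $T\ge 1$ rounds. All samples are independent, those of client $m$ have law $\mathcal P_m$, $\mathcal S$ is the whole dataset and $N=\sum_m N_m$. At round $t$ the memory of client $m$ holds the samples with indices in $\mathcal I_m^{(t)}\subseteq[N_m]$, and sample $j\in\mathcal I_m^{(t)}$ has weight $\lambda_m^{(t,j)}\ge 0$. Arrivals, memories and weights do not depend on the sample values, and the total weight $\Lambda=\sum_{t\le T}\sum_m\sum_{j\in\mathcal I_m^{(t)}}\lambda_m^{(t,j)}$ is positive. Let $\Lambda_m^{(t)}=\sum_{j\in\mathcal I_m^{(t)}}\lambda_m^{(t,j)}$, $\Lambda^{(t)}=\sum_m\Lambda_m^{(t)}$, $p_m^{(t)}=\Lambda_m^{(t)}/\Lambda^{(t)}$ and $q^{(t)}=\Lambda^{(t)}/\Lambda$ (with $0/0=0$), and $$p_{m,i}=\frac1\Lambda\sum_{t\le T:\,i\in\mathcal I_m^{(t)}}\lambda_m^{(t,i)},\qquad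 p_m=\sum_i p_{m,i},\qquad N_{\mathrm{eff}}=\Big(\sum_{m,i}p_{m,i}^2\Big)^{-1}.$$ Let $\Theta\subseteq\mathbb R^d$ and let $\ell(\theta;z)$ be a loss. Put $\mathcal L_Q(\theta)=\mathbb E_{z\sim Q}\,\ell(\theta;z)$, let $\mathcal L_{m}^{(t)}(\theta)=\sum_{j\in\mathcal I_m^{(t)}}\lambda_m^{(t,j)}\ell(\theta;z_m^{(j)})/\Lambda_m^{(t)}$ be the local and $\mathcal L_{\mathcal S}^{(\lambda)}(\theta)=\frac1\Lambda\sum_{m,t}\sum_{j\in\mathcal I_m^{(t)}}\lambda_m^{(t,j)}\ell(\theta;z_m^{(j)})$ the global weighted empirical risk. For weights $a=(a_m)_m$ put $\mathcal P^{(a)}=\sum_m a_m\mathcal P_m$. The label discrepancy is $\mathrm{disc}_{\mathcal H}(Q,Q')=\sup_{\theta\in\Theta}|\mathcal L_Q(\theta)-\mathcal L_{Q'}(\theta)|$. $\mathrm{VCdim}(\mathcal H)$ is the VC dimension of the class of subgraphs $\{(z,u)\in\mathcal Z\times\mathbb R: u<\ell(\theta;z)\}$, $\theta\in\Theta$ (the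 pseudo-dimension of the losses of the hypotheses; for binary classifiers with the $0$–$1$ loss this is the usual VC dimension). The algorithm (full client participation, full batches) starts at $\theta^{(1)}\in\Theta$. In round $t$ each client sets $\theta_m^{(t,1)}=\theta^{(t)}$ and makes $E\ge1$ steps $\theta_m^{(t,e+1)}=\theta_m^{(t,e)}-\eta\nabla\mathcal L_m^{(t)}(\theta_m^{(t,e)})$. The server sets $\theta^{(t+1)}=\mathrm{proj}_\Theta\big(\theta^{(t)}+\sum_m p_m^{(t)}(\theta_m^{(t,E+1)}-\theta^{(t)})\big)$. The output is $A(\mathcal S)=\sum_{t\le T}q^{(t)}\theta^{(t)}$. Let $$\bar\sigma^2=\sum_{t=1}^T q^{(t)}\,\mathbb E_{\mathcal S}\Big[\sup_{\theta\in\Theta}\Big\|\nabla\mathcal L_{\mathcal S}^{(\lambda)}(\theta)-\sum_m p_m^{(t)}\nabla\mathcal L_m^{(t)}(\theta)\Big\|^2\Big].$$ For $\alpha_m\ge0$, $\sum_m\alpha_m=1$, the true error is $\epsilon_{\mathrm{true}}=\mathbb E_{\mathcal S}\big[\mathcal L_{\mathcal P^{(\alpha)}}(A(\mathcal S))\big]-\min_{\theta\in\Theta}\mathcal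 L_{\mathcal P^{(\alpha)}}(\theta)$. **Theorem.** For all $B,D,L,r,c,c_q$ with $r,c>0$ and $L\ge 0$, and every $E\ge1$, there is a constant $C\ge0$, depending on these numbers only, such that the following holds for all data as above. Assume that $\ell(\theta;z)\in[0,B]$ for $\theta\in\Theta$, $z\in\mathcal Z$; that $\Theta$ is convex, closed and bounded with diameter at most $D$ and contains a ball of radius $r$; that $\ell(\cdot;z)$ is convex and $L$-smooth on $\mathbb R^d$ for every $z$; that $q^{(1)}\ge q^{(2)}\ge\dots\ge q^{(T)}$ and $q^{(1)}\le c_q/T$; that $\eta=\frac{c}{\sqrt T}\min\{1,1/\bar\sigma\}$ (equal to $c/\sqrt T$ if $\bar\sigma=0$); and that $\mathrm{VCdim}(\mathcal H)\le v$ for a natural number $v$. Then $$\epsilon_{\mathrm{true}}\le \frac{C}{\sqrt T}+C\,\bar\sigma+2\,\mathrm{disc}_{\mathcal H}\big(\mathcal P^{(\alpha)},\mathcal P^{(p)}\big)+C\sqrt{\frac{v}{N_{\mathrm{eff}}}}\,\sqrt{1+\log^+\frac{N}{v}},$$ where $\log^+x=\max\{0,\log x\}$ (and the last term is $0$ if $v=0$).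 -/

import Mathlib

namespace StreamFL

/-! ### VC dimension -/

/-- A family `C` of subsets of `β` shatters the finite set `s` if every subset of `s` is the trace
on `s` of a member of `C`. -/
def Shatters {β : Type*} (C : Set (Set β)) (s : Finset β) : Prop :=
  ∀ t ⊆ s, ∃ A ∈ C, (s : Set β) ∩ A = (t : Set β)

/-- The Vapnik-Chervonenkis dimension: the supremum of the sizes of the shattered finite sets. -/
noncomputable def vcDim {β : Type*} (C : Set (Set β)) : ℕ∞ :=
  ⨆ (s : Finset β) (_ : Shatters C s), (s.card : ℕ∞)

/-- The model (parameter) space `ℝ^d` with its Euclidean norm. -/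
abbrev Param (d : ℕ) : Type := EuclideanSpace ℝ (Fin d)

variable {Z : Type*} {d M : ℕ}

/-- The VC dimension of the hypothesis class `{h_θ : θ ∈ Θ}`, whose performance is measured by the
real-valued loss `ℓ θ z`: the VC dimension of the class of subgraphs `{(z, u) : u < ℓ θ z}`
(also called the pseudo-dimension of `{ℓ θ : θ ∈ Θ}`). For binary classifiers and the
`0`-`1` loss it is the usual VC dimension of the class. -/
noncomputable def hypothesisVCDim (ℓ : Param d → Z → ℝ) (Θ : Set (Param d)) : ℕ∞ :=
  vcDim ((fun θ : Param d => {x : Z × ℝ | x.2 < ℓ θ x.1}) '' Θ)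

/-! ### Expected risks -/

/-- The expected risk of the parameter `θ` under the distribution `Q`. -/
noncomputable def risk [MeasurableSpace Z] (ℓ : Param d → Z → ℝ)
    (Q : MeasureTheory.Measure Z) (θ : Param d) : ℝ :=
  ∫ z, ℓ θ z ∂Q

/-- The mixture `∑ m, a m • P m` of the clients' distributions. -/
noncomputable def mixture [MeasurableSpace Z] (P : Fin M → MeasureTheory.Measure Z)
    (a : Fin M → ℝ) : MeasureTheory.Measure Z :=
  ∑ m, ENNReal.ofReal (a m) • P m

/-- The label discrepancy between two distributions. -/
noncomputable def disc [MeasurableSpace Z] (ℓ : Param d → Z → ℝ) (Θ : Set (Param d))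
    (Q Q' : MeasureTheory.Measure Z) : ℝ :=
  ⨆ θ : Θ, |risk ℓ Q θ - risk ℓ Q' θ|

/-! ### Data streams, memories and sample weights -/

/-- The sample arrival sequence, the memory update rule and the sample weights of `M` clients, as
far as they matter over a given horizon. The rounds are numbered `0, 1, 2, …`. None of these data
depends on the values of the samples. Every arrival process, every family of memory capacities
and every memory update rule (such as first-in-first-out) gives rise to such data. -/
structure Stream (M : ℕ) where
  /-- `size m` is the number of samples that client `m` collects over the whole horizon. -/
  size : Fin M → ℕ
  /-- `mem m t` is the set of indices of the samples in the memory of client `m` at round `t`. -/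
  mem : (m : Fin M) → ℕ → Finset (Fin (size m))
  /-- `wt m t j` is the weight of sample `j` of client `m` at round `t`. -/
  wt : (m : Fin M) → ℕ → Fin (size m) → ℝ

namespace Stream

/-- The total number of samples, over all clients. -/
def numSamples (W : Stream M) : ℕ := ∑ m, W.size m

/-- The total weight of the memory of client `m` at round `t`. -/
noncomputable def localWeight (W : Stream M) (m : Fin M) (t : ℕ) : ℝ :=
  ∑ j ∈ W.mem m t, W.wt m t j

/-- The total weight of all memories at round `t`. -/
noncomputable def roundWeight (W : Stream M) (t : ℕ) : ℝ := ∑ m, W.localWeight m t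

/-- The total weight over the rounds `0, …, T - 1`. -/
noncomputable def totalWeight (W : Stream M) (T : ℕ) : ℝ :=
  ∑ t ∈ Finset.range T, W.roundWeight t

/-- The aggregation weight of client `m` at round `t`. -/
noncomputable def aggWeight (W : Stream M) (m : Fin M) (t : ℕ) : ℝ :=
  W.localWeight m t / W.roundWeight t

/-- The relative weight of round `t` among the `T` rounds. -/
noncomputable def roundImportance (W : Stream M) (T t : ℕ) : ℝ :=
  W.roundWeight t / W.totalWeight T

/-- The relative importance of sample `i` of client `m` during the whole training. -/
noncomputable def sampleImportance (W : Stream M) (T : ℕ) (m : Fin M) (i : Fin (W.size m)) : ℝ :=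
  (∑ t ∈ Finset.range T, ∑ j ∈ W.mem m t, if j = i then W.wt m t j else 0) / W.totalWeight T

/-- The relative importance of client `m` during the whole training. -/
noncomputable def clientImportance (W : Stream M) (T : ℕ) (m : Fin M) : ℝ :=
  ∑ i, W.sampleImportance T m i

/-- The effective number of samples. -/
noncomputable def effSamples (W : Stream M) (T : ℕ) : ℝ :=
  (∑ m, ∑ i, W.sampleImportance T m i ^ 2)⁻¹

/-- A training dataset: `S m i` is the `i`-th sample of client `m`. -/
abbrev Dataset (W : Stream M) (Z : Type*) : Type _ := (m : Fin M) → Fin (W.size m) → Z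

/-- The law of the training dataset: all samples are independent and those of client `m` have
distribution `P m`. -/
noncomputable def dataLaw [MeasurableSpace Z] (W : Stream M)
    (P : Fin M → MeasureTheory.Measure Z) : MeasureTheory.Measure (W.Dataset Z) :=
  MeasureTheory.Measure.pi fun m => MeasureTheory.Measure.pi fun _ => P m

/-- The weighted empirical risk on the memory of client `m` at round `t`. -/
noncomputable def localRisk (W : Stream M) (ℓ : Param d → Z → ℝ) (S : W.Dataset Z)
    (m : Fin M) (t : ℕ) (θ : Param d) : ℝ :=
  (∑ j ∈ W.mem m t, W.wt m t j * ℓ θ (S m j)) / W.localWeight m t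

/-- The global weighted empirical risk. -/
noncomputable def empRisk (W : Stream M) (ℓ : Param d → Z → ℝ) (T : ℕ) (S : W.Dataset Z)
    (θ : Param d) : ℝ :=
  (∑ m, ∑ t ∈ Finset.range T, ∑ j ∈ W.mem m t, W.wt m t j * ℓ θ (S m j)) / W.totalWeight T

end Stream

/-! ### The algorithm, with full client participation and full batches -/

/-- Euclidean projection: a point of `Θ` nearest to `x` (it exists and is unique if `Θ` is
nonempty, closed and convex). -/
noncomputable def project (Θ : Set (Param d)) (x : Param d) : Param d :=
  Classical.epsilon fun y => y ∈ Θ ∧ ∀ w ∈ Θ, ‖x - y‖ ≤ ‖x - w‖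

namespace Stream

/-- The gradient used by client `m` at round `t`. The batch is the whole memory. -/
noncomputable def localGrad (W : Stream M) (ℓ : Param d → Z → ℝ) (S : W.Dataset Z)
    (m : Fin M) (t : ℕ) (θ : Param d) : Param d :=
  ∑ j ∈ W.mem m t,
    (W.wt m t j / W.localWeight m t) • gradient (fun θ' : Param d => ℓ θ' (S m j)) θ

/-- The local model of client `m` at round `t` after `e` local gradient steps of size `η` from the
broadcast model `θ`. -/
noncomputable def localIter (W : Stream M) (ℓ : Param d → Z → ℝ) (η : ℝ) (S : W.Dataset Z)
    (m : Fin M) (t : ℕ) (θ : Param d) : ℕ → Param d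
  | 0 => θ
  | e + 1 => W.localIter ℓ η S m t θ e - η • W.localGrad ℓ S m t (W.localIter ℓ η S m t θ e)

/-- The global model at the beginning of each round, with `E` local steps per round and with the
initial model `θ₀`. -/
noncomputable def globalIter (W : Stream M) (ℓ : Param d → Z → ℝ) (Θ : Set (Param d)) (E : ℕ)
    (η : ℝ) (θ₀ : Param d) (S : W.Dataset Z) : ℕ → Param d
  | 0 => θ₀
  | t + 1 => project Θ (W.globalIter ℓ Θ E η θ₀ S t +
      ∑ m, W.aggWeight m t •
        (W.localIter ℓ η S m t (W.globalIter ℓ Θ E η θ₀ S t) E - W.globalIter ℓ Θ E η θ₀ S t))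

/-- The output of the algorithm after `T` rounds. -/
noncomputable def output (W : Stream M) (ℓ : Param d → Z → ℝ) (Θ : Set (Param d)) (E : ℕ)
    (η : ℝ) (θ₀ : Param d) (T : ℕ) (S : W.Dataset Z) : Param d :=
  ∑ t ∈ Finset.range T, W.roundImportance T t • W.globalIter ℓ Θ E η θ₀ S t

/-- The gradient variability `σ̄`, the square root of the weighted average over the rounds of the
expected squared distance, uniformly over `Θ`, between the gradient of the global weighted
empirical risk and the aggregated gradient of the round. -/
noncomputable def gradVariability [MeasurableSpace Z] (W : Stream M) (ℓ : Param d → Z → ℝ)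
    (Θ : Set (Param d)) (P : Fin M → MeasureTheory.Measure Z) (T : ℕ) : ℝ :=
  Real.sqrt (∑ t ∈ Finset.range T, W.roundImportance T t *
    ∫ S, (⨆ θ : Θ, ‖gradient (W.empRisk ℓ T S) (θ : Param d) -
      ∑ m, W.aggWeight m t • gradient (W.localRisk ℓ S m t) (θ : Param d)‖ ^ 2) ∂(W.dataLaw P))

/-- The true error of the output of the algorithm for the target distribution `∑ m, α m • P m`. -/
noncomputable def trueError [MeasurableSpace Z] (W : Stream M) (ℓ : Param d → Z → ℝ)
    (Θ : Set (Param d)) (P : Fin M → MeasureTheory.Measure Z) (α : Fin M → ℝ) (E : ℕ) (η : ℝ)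
    (θ₀ : Param d) (T : ℕ) : ℝ :=
  (∫ S, risk ℓ (mixture P α) (W.output ℓ Θ E η θ₀ T S) ∂(W.dataLaw P)) -
    ⨅ θ : Θ, risk ℓ (mixture P α) θ

end Stream

end StreamFL

namespace StreamFL

open MeasureTheory Finset

/-! ### Growth function of a class of finite VC dimension -/

/-! Compare the output with a fixed competitor `w` in `Θ`. Passing from the target mixture to the
training mixture at the output, and back at `w`, costs one discrepancy each. In between stand the
gap between risk and empirical risk at the output, and the excess empirical risk of the output over
`w`. The output depends on the data, so its gap is bounded uniformly over `Θ`; `w` does not, so its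
expected empirical risk is exactly its risk under the training mixture
(`Stream.Weighted.trueError_le`).

Uniform deviation: the empirical risk is a sum of independent losses with deterministic weights
p_{m,i}. A ghost sample and random signs lead to Rademacher averages (`integral_iSup_deviation_le`).
Each loss is the integral over levels u in (0, B] of the indicators of u < loss. At one level
Sauer–Shelah bounds the number of traces (`card_traces_le`) and Massart's lemma applies; the same
bound holds at every level, so integration costs only a factor B (`rademacher_average_le`). The sum
of squared weights is 1/N_eff.

Optimization: gradients are bounded on `Θ`, so the E local steps of a round amount to one gradient
step of length ηE along the aggregated gradient, up to O(η²) (`Stream.Weighted.norm_update_le`).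
Replacing this gradient by that of the global empirical risk costs the gradient gap times the
diameter. Averaging with the nonincreasing weights q^(t), Abel summation leaves only the initial
distance times q^(1) (`Stream.Weighted.optimization_error_le`). The expected average gap is at most
σ̄ by Jensen, and q^(1) = O(1/T) against η of order 1/(√T max(1, σ̄)) yields the rate. -/

lemma sum_choose_le_exp {v : ℕ} (hv : 0 < v) (n : ℕ) :
    (∑ k ∈ range (v + 1), (n.choose k : ℝ)) ≤ Real.exp (v * (1 + Real.posLog (n / v))) := by
  have hv' : (0 : ℝ) < v := by exact_mod_cast hv
  rcases Nat.eq_zero_or_pos n with rfl | hn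
  · rw [sum_range_succ']
    simp only [Nat.choose_zero_succ, Nat.cast_zero, sum_const_zero, Nat.choose_self, Nat.cast_one,
      zero_add]
    apply Real.one_le_exp
    have := Real.posLog_nonneg (x := (0 : ℝ) / v)
    positivity
  have hn' : (0 : ℝ) < n := by exact_mod_cast hn
  -- Chernoff-type tilt: for `x` in (0, 1] the sum is at most (1+x)^n / x^v. The choice x = min(1,
  -- v/n) makes (1+x)^n at most e^v, and its two cases produce the positive part of the logarithm.
  obtain ⟨x, hx0, hx1, hnx, hlog⟩ : ∃ x : ℝ, 0 < x ∧ x ≤ 1 ∧ n * x ≤ v ∧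
      -Real.log x ≤ Real.posLog (n / v) := by
    rcases le_total (n : ℝ) v with h | h
    · exact ⟨1, one_pos, le_rfl, by simpa using h, by simpa using Real.posLog_nonneg⟩
    · refine ⟨v / n, by positivity, (div_le_one hn').2 h, (mul_div_cancel₀ _ hn'.ne').le, ?_⟩
      rw [← Real.log_inv, inv_div]
      exact le_max_right _ _
  have key : (∑ k ∈ range (v + 1), (n.choose k : ℝ)) * x ^ v ≤ (1 + x) ^ n := by
    calc (∑ k ∈ range (v + 1), (n.choose k : ℝ)) * x ^ v
        ≤ ∑ k ∈ range (v + 1), x ^ k * n.choose k := by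
          rw [sum_mul]
          refine sum_le_sum fun k hk => ?_
          rw [mul_comm]
          exact mul_le_mul_of_nonneg_right
            (pow_le_pow_of_le_one hx0.le hx1 (Nat.lt_succ_iff.1 (mem_range.1 hk)))
            (Nat.cast_nonneg _)
      -- A range containing both `range (v + 1)` and `range (n + 1)` avoids comparing `v` with `n`;
      -- the binomials beyond `n` vanish.
      _ ≤ ∑ k ∈ range (v + 1 + (n + 1)), x ^ k * n.choose k :=
          sum_le_sum_of_subset_of_nonneg (range_subset_range.2 (by omega))
            fun _ _ _ => by positivity
      _ = ∑ k ∈ range (n + 1), x ^ k * n.choose k := by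
          symm
          refine sum_subset (range_subset_range.2 (by omega)) fun k _ hk => ?_
          rw [Nat.choose_eq_zero_of_lt (by simpa using hk)]
          simp
      _ = (1 + x) ^ n := by
          rw [add_comm 1 x, add_pow]
          simp
  have hpow : (1 + x) ^ n ≤ Real.exp v := by
    calc (1 + x) ^ n ≤ Real.exp x ^ n :=
          pow_le_pow_left₀ (by positivity) (by linarith [Real.add_one_le_exp x]) n
      _ = Real.exp (n * x) := by rw [← Real.exp_nat_mul]
      _ ≤ Real.exp v := Real.exp_le_exp.2 hnx
  have hxv : x ^ v = Real.exp (-(v * -Real.log x)) := by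
    rw [mul_neg, neg_neg, Real.exp_nat_mul, Real.exp_log hx0]
  have hpos : 0 < x ^ v := by positivity
  calc (∑ k ∈ range (v + 1), (n.choose k : ℝ))
      ≤ Real.exp v / x ^ v := (le_div_iff₀ hpos).2 (key.trans hpow)
    _ = Real.exp (v + v * -Real.log x) := by
        rw [hxv, ← Real.exp_sub]
        congr 1
        ring
    _ ≤ Real.exp (v * (1 + Real.posLog (n / v))) := by
        apply Real.exp_le_exp.2
        have := mul_le_mul_of_nonneg_left hlog hv'.le
        linarith

/-- The traces on a finite sample of the superlevel sets, at a fixed level, of a class of functions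
whose subgraphs have VC dimension at most `v`. -/
lemma card_traces_le {ι K Z : Type*} [Fintype ι] [DecidableEq ι] (f : K → Z → ℝ) (x : ι → Z)
    (u : ℝ) {v : ℕ} (hv : 0 < v)
    (hvc : vcDim (Set.range fun k => {y : Z × ℝ | y.2 < f k y.1}) ≤ v)
    (𝒜 : Finset (Finset ι)) (h𝒜 : ∀ a ∈ 𝒜, ∃ k, ∀ i, i ∈ a ↔ u < f k (x i)) :
    (𝒜.card : ℝ) ≤ Real.exp (v * (1 + Real.posLog (Fintype.card ι / v))) := by
  classical
  have hdim : 𝒜.vcDim ≤ v := by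
    refine Finset.sup_le fun s hs => ?_
    rw [mem_shatterer] at hs
    -- Two indices carrying the same sample point belong to the same traces, so a shattered index
    -- set cannot contain both. Hence it has as many points (x i, u), and these are shattered by the
    -- subgraphs.
    have hinj : Set.InjOn (fun i => (x i, u)) (s : Set ι) := by
      intro i hi j hj hij
      have hxij : x i = x j := congrArg Prod.fst hij
      obtain ⟨a, ha, has⟩ := hs.exists_inter_eq_singleton hi
      obtain ⟨k, hk⟩ := h𝒜 a ha
      have hia : i ∈ a := (mem_inter.1 (has ▸ mem_singleton_self i : i ∈ s ∩ a)).2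
      have hja : j ∈ a := by rw [hk, ← hxij, ← hk]; exact hia
      have : j ∈ s ∩ a := mem_inter.2 ⟨hj, hja⟩
      rw [has, mem_singleton] at this
      exact this.symm
    have hsh : Shatters (Set.range fun k => {y : Z × ℝ | y.2 < f k y.1})
        (s.image fun i => (x i, u)) := by
      intro t ht
      obtain ⟨a, ha, has⟩ := hs (filter_subset (fun i => (x i, u) ∈ t) s)
      obtain ⟨k, hk⟩ := h𝒜 a ha
      refine ⟨_, ⟨k, rfl⟩, ?_⟩
      ext y
      simp only [Set.mem_inter_iff, mem_coe, mem_image]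
      constructor
      · rintro ⟨⟨i, hi, rfl⟩, hy⟩
        have hia : i ∈ s ∩ a := mem_inter.2 ⟨hi, (hk i).2 hy⟩
        rw [has] at hia
        exact (mem_filter.1 hia).2
      · intro hy
        obtain ⟨i, hi, rfl⟩ := mem_image.1 (ht hy)
        refine ⟨⟨i, hi, rfl⟩, ?_⟩
        have hia : i ∈ s ∩ a := by
          rw [has]
          exact mem_filter.2 ⟨hi, hy⟩
        exact (hk i).1 (mem_inter.1 hia).2
    have h1 : ((s.image fun i => (x i, u)).card : ℕ∞) ≤ v :=
      (le_iSup₂ (f := fun (s : Finset (Z × ℝ)) (_ : Shatters _ s) => (s.card : ℕ∞)) _ hsh).trans hvc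
    rw [card_image_of_injOn hinj] at h1
    exact_mod_cast h1
  refine le_trans ?_ (sum_choose_le_exp hv (Fintype.card ι))
  -- Pajor's inequality followed by the Sauer–Shelah count of the shattered sets.
  have h2 := (card_le_card_shatterer 𝒜).trans card_shatterer_le_sum_vcDim
  have h3 : ∑ k ∈ Iic 𝒜.vcDim, (Fintype.card ι).choose k
      ≤ ∑ k ∈ range (v + 1), (Fintype.card ι).choose k :=
    sum_le_sum_of_subset fun k hk => by
      rw [mem_Iic] at hk
      rw [mem_range]
      omega
  exact_mod_cast h2.trans h3

/-! ### Rademacher averages -/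

/-- The sign of a Boolean. -/
def boolSign (b : Bool) : ℝ := if b then 1 else -1

lemma boolSign_not (b : Bool) : boolSign (!b) = -boolSign b := by
  cases b <;> simp [boolSign]

lemma abs_boolSign (b : Bool) : |boolSign b| = 1 := by
  cases b <;> simp [boolSign]

/-- Independence of the signs factorizes the exponential moment. A coordinate in `a` contributes 2
cosh(l w_i) ≤ 2 exp(l² w_i² / 2), any other contributes 2. -/
lemma sum_exp_signed_sum_le {ι : Type*} [Fintype ι] [DecidableEq ι] (w : ι → ℝ) (a : Finset ι)
    (l : ℝ) :
    ∑ ε : ι → Bool, Real.exp (l * ∑ i ∈ a, boolSign (ε i) * w i) ≤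
      2 ^ Fintype.card ι * Real.exp (l ^ 2 * (∑ i, w i ^ 2) / 2) := by
  have h1 : ∀ ε : ι → Bool, Real.exp (l * ∑ i ∈ a, boolSign (ε i) * w i) =
      ∏ i, Real.exp (if i ∈ a then l * (boolSign (ε i) * w i) else 0) := by
    intro ε
    rw [← Real.exp_sum, mul_sum, sum_ite_mem, univ_inter]
  have h2 : ∏ i, ∑ b : Bool, Real.exp (if i ∈ a then l * (boolSign b * w i) else 0) =
      ∑ ε : ι → Bool, ∏ i, Real.exp (if i ∈ a then l * (boolSign (ε i) * w i) else 0) := by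
    rw [prod_univ_sum, Fintype.piFinset_univ]
  rw [sum_congr rfl fun ε _ => h1 ε, ← h2, ← Finset.card_univ, ← prod_const, mul_sum, sum_div,
    Real.exp_sum, ← prod_mul_distrib]
  refine prod_le_prod (fun i _ => by positivity) fun i _ => ?_
  by_cases hi : i ∈ a
  · have := Real.cosh_le_exp_half_sq (l * w i)
    rw [Real.cosh_eq, mul_pow] at this
    simp only [hi, if_true, Fintype.sum_bool, boolSign, Bool.false_eq_true, if_false, one_mul,
      neg_mul, mul_neg]
    linarith
  · simp only [hi, if_false, Fintype.sum_bool, Real.exp_zero]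
    have : 1 ≤ Real.exp (l ^ 2 * w i ^ 2 / 2) := Real.one_le_exp (by positivity)
    linarith

/-- Massart's lemma. -/
lemma sum_iSup_signed_sum_le {ι K : Type*} [Fintype ι] [DecidableEq ι] [Nonempty K]
    (w : ι → ℝ) (𝒜 : Finset (Finset ι)) {H : ℝ} (hH : 0 < H)
    (hcard : (𝒜.card : ℝ) ≤ Real.exp H) (a : K → Finset ι) (ha : ∀ k, a k ∈ 𝒜) :
    ∑ ε : ι → Bool, ⨆ k, ∑ i ∈ a k, boolSign (ε i) * w i ≤
      2 ^ Fintype.card ι * (2 * Real.sqrt (H * ∑ i, w i ^ 2)) := by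
  obtain ⟨s, hs⟩ : ∃ s, s = ∑ i, w i ^ 2 := ⟨_, rfl⟩
  have hs0 : 0 ≤ s := hs ▸ sum_nonneg fun i _ => sq_nonneg (w i)
  rw [← hs]
  rcases hs0.eq_or_lt with h0 | hpos
  · have hw : ∀ i, w i = 0 := by
      intro i
      have := (sum_eq_zero_iff_of_nonneg fun i _ => sq_nonneg (w i)).1 (hs.symm.trans h0.symm) i
        (mem_univ i)
      simpa using this
    simp [hw]
  -- This `l` equalizes H/l and l s, both √(H s); the bound c/l below is then (3/2)√(H s), rounded
  -- up to 2√(H s).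
  set l := Real.sqrt (H / s) with hl
  have hl0 : 0 < l := Real.sqrt_pos.2 (by positivity)
  have hl2 : l ^ 2 * s = H := by
    rw [hl, Real.sq_sqrt (by positivity)]
    field_simp
  have hls : l * s = Real.sqrt (H * s) := by
    rw [hl]
    nth_rewrite 2 [← Real.sqrt_sq hpos.le]
    rw [← Real.sqrt_mul (by positivity)]
    congr 1
    field_simp
  set c := H + l ^ 2 * s / 2 with hc
  -- The tangent line y ≤ exp(y - c) - 1 + c replaces the usual logarithm and Jensen step. The shift
  -- `c` makes the sign average of the sum over `𝒜` of exp(y - c) at most 1, cancelling the -1.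
  have hsup : ∀ ε : ι → Bool, ⨆ k, ∑ i ∈ a k, boolSign (ε i) * w i ≤
      (∑ b ∈ 𝒜, Real.exp (l * ∑ i ∈ b, boolSign (ε i) * w i) * Real.exp (-c) - 1 + c) / l := by
    intro ε
    refine ciSup_le fun k => ?_
    rw [le_div_iff₀ hl0]
    have h1 := Real.add_one_le_exp (l * ∑ i ∈ a k, boolSign (ε i) * w i - c)
    rw [sub_eq_add_neg, Real.exp_add] at h1
    have h2 := single_le_sum (f := fun b => Real.exp (l * ∑ i ∈ b, boolSign (ε i) * w i) *
      Real.exp (-c)) (fun b _ => by positivity) (ha k)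
    linarith
  refine (sum_le_sum fun ε _ => hsup ε).trans ?_
  have hn : (0 : ℝ) < 2 ^ Fintype.card ι := by positivity
  have hbound : ∑ ε : ι → Bool, ∑ b ∈ 𝒜, Real.exp (l * ∑ i ∈ b, boolSign (ε i) * w i) *
      Real.exp (-c) ≤ 2 ^ Fintype.card ι := by
    rw [sum_comm]
    calc ∑ b ∈ 𝒜, ∑ ε : ι → Bool, Real.exp (l * ∑ i ∈ b, boolSign (ε i) * w i) * Real.exp (-c)
        ≤ ∑ _b ∈ 𝒜, 2 ^ Fintype.card ι * Real.exp (l ^ 2 * s / 2) * Real.exp (-c) := by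
          refine sum_le_sum fun b _ => ?_
          rw [← sum_mul]
          rw [hs]
          exact mul_le_mul_of_nonneg_right (sum_exp_signed_sum_le w b l) (by positivity)
      _ = 2 ^ Fintype.card ι * ((𝒜.card : ℝ) * Real.exp (-H)) := by
          rw [sum_const, nsmul_eq_mul, mul_assoc (2 ^ Fintype.card ι), ← Real.exp_add, hc]
          rw [show l ^ 2 * s / 2 + -(H + l ^ 2 * s / 2) = -H by ring]
          ring
      _ ≤ 2 ^ Fintype.card ι * (Real.exp H * Real.exp (-H)) := by gcongr
      _ = 2 ^ Fintype.card ι := by rw [← Real.exp_add]; simp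
  have hcl : c / l ≤ 2 * Real.sqrt (H * s) := by
    rw [div_le_iff₀ hl0, ← hls, hc]
    nlinarith
  rw [← sum_div, sum_add_distrib, sum_sub_distrib]
  simp only [sum_const, card_univ, Fintype.card_pi, Fintype.card_bool, prod_const, nsmul_eq_mul,
    mul_one, Nat.cast_pow, Nat.cast_ofNat]
  calc _ ≤ (2 ^ Fintype.card ι * c) / l := by
        gcongr
        linarith
    _ = 2 ^ Fintype.card ι * (c / l) := by ring
    _ ≤ _ := by gcongr

lemma setIntegral_indicator_lt {B y : ℝ} (hy : y ∈ Set.Icc 0 B) :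
    ∫ u in Set.Ioc 0 B, (if u < y then (1 : ℝ) else 0) = y := by
  have h1 : (fun u : ℝ => if u < y then (1 : ℝ) else 0) = (Set.Iio y).indicator 1 := by
    ext u
    simp [Set.indicator_apply]
  have h2 : Set.Ioc 0 B ∩ Set.Iio y = Set.Ioo 0 y := by
    ext u
    simp only [Set.mem_inter_iff, Set.mem_Ioc, Set.mem_Iio, Set.mem_Ioo]
    exact ⟨fun h => ⟨h.1.1, h.2⟩, fun h => ⟨⟨h.1, (h.2.trans_le hy.2).le⟩, h.2⟩⟩
  rw [h1, integral_indicator_one measurableSet_Iio, Measure.real,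
    Measure.restrict_apply measurableSet_Iio, Set.inter_comm, h2, Real.volume_Ioo, sub_zero,
    ENNReal.toReal_ofReal hy.1]

lemma abs_signed_sum_le {ι K : Type*} [Fintype ι] (w c : ι → ℝ) (hc : ∀ i, |c i| = 1)
    {B : ℝ} (g : K → ι → ℝ) (hg : ∀ k i, g k i ∈ Set.Icc 0 B) (k : K) :
    |∑ i, c i * w i * g k i| ≤ ∑ i, |w i| * B := by
  refine (abs_sum_le_sum_abs _ _).trans (sum_le_sum fun i _ => ?_)
  rw [abs_mul, abs_mul, hc, one_mul, abs_of_nonneg (hg k i).1]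
  exact mul_le_mul_of_nonneg_left (hg k i).2 (abs_nonneg _)

/-- Real suprema are meaningful only for families bounded above; uniform bounds on the classes
supply this here and in `le_iSup_of_abs_le`. -/
lemma abs_iSup_le {K : Type*} [Nonempty K] {g : K → ℝ} {b : ℝ} (h : ∀ k, |g k| ≤ b) :
    |⨆ k, g k| ≤ b := by
  have hb : BddAbove (Set.range g) := ⟨b, by rintro _ ⟨k, rfl⟩; exact (abs_le.1 (h k)).2⟩
  rw [abs_le]
  obtain ⟨k⟩ := (inferInstance : Nonempty K)
  exact ⟨(abs_le.1 (h k)).1.trans (le_ciSup hb k), ciSup_le fun k => (abs_le.1 (h k)).2⟩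

lemma le_iSup_of_abs_le {K : Type*} {g : K → ℝ} {b : ℝ} (h : ∀ k, |g k| ≤ b) (k : K) :
    g k ≤ ⨆ k, g k :=
  le_ciSup (⟨b, by rintro _ ⟨k, rfl⟩; exact (abs_le.1 (h k)).2⟩ : BddAbove (Set.range g)) k

/-- The Rademacher average of a class of functions whose subgraphs have bounded VC dimension. -/
lemma rademacher_average_le {ι K Z : Type*} [Fintype ι] [DecidableEq ι] [Countable K] [Nonempty K]
    (f : K → Z → ℝ) {B : ℝ} (hB : 0 ≤ B) (hf : ∀ k z, f k z ∈ Set.Icc 0 B) (x : ι → Z)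
    (w : ι → ℝ) {v : ℕ} (hv : 0 < v)
    (hvc : vcDim (Set.range fun k => {y : Z × ℝ | y.2 < f k y.1}) ≤ v) :
    ∑ ε : ι → Bool, ⨆ k, ∑ i, boolSign (ε i) * w i * f k (x i) ≤
      2 ^ Fintype.card ι *
        (2 * B * Real.sqrt (v * (1 + Real.posLog (Fintype.card ι / v)) * ∑ i, w i ^ 2)) := by
  classical
  set H : ℝ := v * (1 + Real.posLog (Fintype.card ι / v)) with hHdef
  have hH : 0 < H := by
    have := Real.posLog_nonneg (x := (Fintype.card ι : ℝ) / v)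
    have : (0 : ℝ) < v := by exact_mod_cast hv
    positivity
  set g : (ι → Bool) → K → ℝ → ℝ := fun ε k u =>
    ∑ i, boolSign (ε i) * w i * (if u < f k (x i) then (1 : ℝ) else 0) with hg
  have hgm : ∀ ε k, Measurable (g ε k) := by
    intro ε k
    refine Finset.measurable_sum _ fun i _ => Measurable.const_mul ?_ _
    exact Measurable.ite measurableSet_Iio measurable_const measurable_const
  have hgb : ∀ ε k u, |g ε k u| ≤ ∑ i, |w i| * 1 := fun ε k u =>
    abs_signed_sum_le (K := K) w (fun i => boolSign (ε i)) (fun i => abs_boolSign _)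
      (fun k i => if u < f k (x i) then (1 : ℝ) else 0)
      (fun k i => by
        split_ifs <;> simp) k
  have hint : ∀ (h : ℝ → ℝ), Measurable h → (∀ u, |h u| ≤ ∑ i, |w i| * 1) →
      IntegrableOn h (Set.Ioc 0 B) := fun h hm hb =>
    Measure.integrableOn_of_bounded (by simp) hm.aestronglyMeasurable
      (Filter.Eventually.of_forall hb)
  have hsm : ∀ ε, Measurable fun u => ⨆ k, g ε k u := fun ε => Measurable.iSup (hgm ε)
  have hsb : ∀ ε u, |⨆ k, g ε k u| ≤ ∑ i, |w i| * 1 := fun ε u => abs_iSup_le fun k => hgb ε k u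
  -- Layer cake, by linearity in the values `f k (x i)`.
  have hcake : ∀ ε k, ∑ i, boolSign (ε i) * w i * f k (x i) = ∫ u in Set.Ioc 0 B, g ε k u := by
    intro ε k
    rw [hg]
    simp only
    rw [integral_finsetSum]
    · refine sum_congr rfl fun i _ => ?_
      rw [integral_const_mul, setIntegral_indicator_lt (hf k (x i))]
    · intro i _
      refine Integrable.const_mul ?_ _
      refine Measure.integrableOn_of_bounded (M := 1) (by simp)
        (Measurable.ite measurableSet_Iio measurable_const
          measurable_const).aestronglyMeasurable (Filter.Eventually.of_forall fun u => ?_)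
      split_ifs <;> simp
  -- At a fixed level only the superlevel sets within the sample matter, and `H` does not depend on
  -- the level.
  have hlevel : ∀ u, ∑ ε : ι → Bool, ⨆ k, g ε k u ≤
      2 ^ Fintype.card ι * (2 * Real.sqrt (H * ∑ i, w i ^ 2)) := by
    intro u
    have := sum_iSup_signed_sum_le w
      (univ.filter fun a : Finset ι => ∃ k, ∀ i, i ∈ a ↔ u < f k (x i))
      hH (card_traces_le f x u hv hvc _ fun a ha => (mem_filter.1 ha).2)
      (fun k => univ.filter fun i => u < f k (x i)) (fun k => by simpa using ⟨k, fun i => Iff.rfl⟩)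
    refine le_trans (le_of_eq ?_) this
    refine sum_congr rfl fun ε _ => ?_
    congr 1
    ext k
    rw [hg]
    simp only [mul_ite, mul_one, mul_zero]
    rw [sum_filter]
  calc ∑ ε : ι → Bool, ⨆ k, ∑ i, boolSign (ε i) * w i * f k (x i)
      ≤ ∑ ε : ι → Bool, ∫ u in Set.Ioc 0 B, ⨆ k, g ε k u := by
        refine sum_le_sum fun ε _ => ciSup_le fun k => ?_
        rw [hcake]
        exact integral_mono (hint _ (hgm ε k) (hgb ε k)) (hint _ (hsm ε) (hsb ε))
          fun u => le_iSup_of_abs_le (fun k => hgb ε k u) k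
    _ = ∫ u in Set.Ioc 0 B, ∑ ε : ι → Bool, ⨆ k, g ε k u :=
        (integral_finsetSum _ fun ε _ => hint _ (hsm ε) (hsb ε)).symm
    _ ≤ ∫ u in Set.Ioc 0 B, 2 ^ Fintype.card ι * (2 * Real.sqrt (H * ∑ i, w i ^ 2)) :=
        integral_mono (integrable_finsetSum _ fun ε _ => hint _ (hsm ε) (hsb ε))
          (integrable_const _) hlevel
    _ = _ := by
        rw [integral_const]
        simp [Measure.real, hB]
        ring

/-! ### Symmetrization -/

lemma integrable_of_abs_le {Ω : Type*} [MeasurableSpace Ω] {μ : Measure Ω} [IsFiniteMeasure μ]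
    {g : Ω → ℝ} (hg : Measurable g) {b : ℝ} (hb : ∀ ω, |g ω| ≤ b) : Integrable g μ :=
  Integrable.of_bound hg.aestronglyMeasurable b (Filter.Eventually.of_forall hb)

/-- Exchange of the two samples of a pair. -/
def swapIf {Z : Type*} (b : Bool) (y : Z × Z) : Z × Z := if b then y else y.swap

lemma measurePreserving_swapIf {Z : Type*} [MeasurableSpace Z] (b : Bool) (Q : Measure Z)
    [SFinite Q] : MeasurePreserving (swapIf b) (Q.prod Q) (Q.prod Q) := by
  cases b
  · exact Measure.measurePreserving_swap
  · exact MeasurePreserving.id _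

lemma sub_swapIf {Z : Type*} (b : Bool) (y : Z × Z) (g : Z → ℝ) :
    g (swapIf b y).2 - g (swapIf b y).1 = boolSign b * (g y.2 - g y.1) := by
  cases b <;> simp [swapIf, boolSign]

/-- The expected supremum of the deviations of weighted averages from their means. -/
theorem integral_iSup_deviation_le {ι K Z : Type*} [Fintype ι] [Countable K] [Nonempty K]
    [MeasurableSpace Z] (P : ι → Measure Z) [∀ i, IsProbabilityMeasure (P i)]
    (f : K → Z → ℝ) (hfm : ∀ k, Measurable (f k)) {B : ℝ} (hB : 0 ≤ B)
    (hf : ∀ k z, f k z ∈ Set.Icc 0 B) (w : ι → ℝ) {v : ℕ} (hv : 0 < v)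
    (hvc : vcDim (Set.range fun k => {y : Z × ℝ | y.2 < f k y.1}) ≤ v) :
    ∫ S, (⨆ k, ∑ i, w i * (∫ z, f k z ∂(P i) - f k (S i))) ∂(Measure.pi P) ≤
      4 * B * Real.sqrt (v * (1 + Real.posLog (Fintype.card ι / v)) * ∑ i, w i ^ 2) := by
  classical
  set R := Real.sqrt (v * (1 + Real.posLog (Fintype.card ι / v)) * ∑ i, w i ^ 2) with hR
  set b : ℝ := ∑ i, |w i| * B with hb
  have hsub : ∀ {x y : ℝ}, x ∈ Set.Icc 0 B → y ∈ Set.Icc 0 B → |x - y| ≤ B := by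
    rintro x y ⟨hx, hx'⟩ ⟨hy, hy'⟩
    rw [abs_le]
    constructor <;> linarith
  have hlin : ∀ c : ι → ℝ, (∀ i, |c i| ≤ B) → |∑ i, w i * c i| ≤ b := by
    intro c hc
    refine (abs_sum_le_sum_abs _ _).trans (sum_le_sum fun i _ => ?_)
    rw [abs_mul]
    exact mul_le_mul_of_nonneg_left (hc i) (abs_nonneg _)
  have hfint : ∀ k i, Integrable (f k) (P i) := fun k i =>
    Integrable.of_bound (hfm k).aestronglyMeasurable B (Filter.Eventually.of_forall fun z => by
      rw [Real.norm_eq_abs, abs_of_nonneg (hf k z).1]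
      exact (hf k z).2)
  have hmean : ∀ k i, ∫ z, f k z ∂(P i) ∈ Set.Icc 0 B := by
    intro k i
    refine ⟨integral_nonneg fun z => (hf k z).1, ?_⟩
    calc ∫ z, f k z ∂(P i) ≤ ∫ _, B ∂(P i) :=
          integral_mono (hfint k i) (integrable_const _) fun z => (hf k z).2
      _ = B := by simp
  -- the supremum over the pairs of a sample and a ghost sample
  set G : (ι → Z × Z) → ℝ := fun y => ⨆ k, ∑ i, w i * (f k (y i).2 - f k (y i).1) with hG
  have hGb : ∀ y, |G y| ≤ b := fun y => abs_iSup_le fun k =>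
    hlin _ fun i => hsub (hf k _) (hf k _)
  have hGm : Measurable G := by
    refine Measurable.iSup fun k => Finset.measurable_sum _ fun i _ => Measurable.const_mul ?_ _
    exact ((hfm k).comp (measurable_snd.comp (measurable_pi_apply i))).sub
      ((hfm k).comp (measurable_fst.comp (measurable_pi_apply i)))
  set μ := Measure.pi P with hμ
  set ν : Measure (ι → Z × Z) := Measure.pi fun i => (P i).prod (P i) with hν
  set e := MeasurableEquiv.arrowProdEquivProdArrow Z Z ι with he
  have hpres : MeasurePreserving e ν (μ.prod μ) :=
    measurePreserving_arrowProdEquivProdArrow Z Z ι P P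
  -- Each mean is an expectation over an independent ghost sample, and the supremum of expectations
  -- is at most the expectation of the supremum.
  have hghost : ∀ S, (⨆ k, ∑ i, w i * (∫ z, f k z ∂(P i) - f k (S i))) ≤
      ∫ S', G (e.symm (S, S')) ∂μ := by
    intro S
    refine ciSup_le fun k => ?_
    have hcoord : ∀ i, Integrable (fun S' : ι → Z => f k (S' i)) μ := fun i =>
      ((measurePreserving_eval P i).integrable_comp (hfm k).aestronglyMeasurable).2 (hfint k i)
    have hmeas : Measurable fun S' : ι → Z => e.symm (S, S') :=
      e.symm.measurable.comp measurable_prodMk_left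
    have : ∑ i, w i * (∫ z, f k z ∂(P i) - f k (S i)) =
        ∫ S', ∑ i, w i * (f k (S' i) - f k (S i)) ∂μ := by
      have hint : ∀ i ∈ (univ : Finset ι),
          Integrable (fun S' : ι → Z => w i * (f k (S' i) - f k (S i))) μ := fun i _ =>
        ((hcoord i).sub (integrable_const _)).const_mul _
      rw [integral_finsetSum _ hint]
      refine sum_congr rfl fun i _ => ?_
      rw [integral_const_mul, integral_sub (hcoord i) (integrable_const _), integral_const]
      have h1 : ∫ S' : ι → Z, f k (S' i) ∂μ = ∫ z, f k z ∂(P i) := by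
        rw [← (measurePreserving_eval P i).map_eq,
          integral_map (measurable_pi_apply i).aemeasurable (hfm k).aestronglyMeasurable]
      rw [h1]
      simp
    rw [this]
    refine integral_mono (integrable_of_abs_le (b := b) ?_ fun S' => ?_)
      (integrable_of_abs_le (b := b) (hGm.comp hmeas) fun S' => hGb _) fun S' => ?_
    · exact Finset.measurable_sum _ fun i _ => Measurable.const_mul
        (((hfm k).comp (measurable_pi_apply i)).sub measurable_const) _
    · exact hlin _ fun i => hsub (hf k _) (hf k _)
    · exact le_iSup_of_abs_le (g := fun k => ∑ i, w i * (f k (S' i) - f k (S i))) (b := b)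
        (fun k => hlin _ fun i => hsub (hf k _) (hf k _)) k
  -- A sample and its ghost have the same law, so exchanging them where the sign is negative leaves
  -- the expectation unchanged.
  have hswap : ∀ ε : ι → Bool, ∫ y, G y ∂ν =
      ∫ y, ⨆ k, ∑ i, boolSign (ε i) * w i * (f k (y i).2 - f k (y i).1) ∂ν := by
    intro ε
    have hp : MeasurePreserving (fun (y : ι → Z × Z) i => swapIf (ε i) (y i)) ν ν :=
      measurePreserving_pi _ _ fun i => measurePreserving_swapIf (ε i) (P i)
    conv_lhs => rw [← hp.map_eq]
    rw [integral_map hp.measurable.aemeasurable hGm.aestronglyMeasurable]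
    refine integral_congr_ae (Filter.Eventually.of_forall fun y => ?_)
    simp only [hG]
    refine iSup_congr fun k => sum_congr rfl fun i _ => ?_
    rw [sub_swapIf (ε i) (y i) (f k)]
    ring
  -- for fixed samples, the average over the signs is a Rademacher average
  have hwin : ∀ (c : ι → Bool) (x : ι → Z) k,
      |∑ i, boolSign (c i) * w i * f k (x i)| ≤ b := fun c x k =>
    abs_signed_sum_le (K := K) w (fun i => boolSign (c i)) (fun i => abs_boolSign _)
      (fun k i => f k (x i)) (fun k i => hf k _) k
  have hwin' : ∀ (ε : ι → Bool) (y : ι → Z × Z) k,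
      |∑ i, boolSign (ε i) * w i * (f k (y i).2 - f k (y i).1)| ≤ b := by
    intro ε y k
    have := hlin (fun i => boolSign (ε i) * (f k (y i).2 - f k (y i).1)) fun i => by
      rw [abs_mul, abs_boolSign, one_mul]
      exact hsub (hf k _) (hf k _)
    convert this using 3 with i
    ring
  have hrad : ∀ y : ι → Z × Z,
      ∑ ε : ι → Bool, ⨆ k, ∑ i, boolSign (ε i) * w i * (f k (y i).2 - f k (y i).1) ≤
        2 ^ Fintype.card ι * (4 * B * R) := by
    intro y
    have hsplit : ∀ ε : ι → Bool,
        ⨆ k, ∑ i, boolSign (ε i) * w i * (f k (y i).2 - f k (y i).1) ≤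
          (⨆ k, ∑ i, boolSign (ε i) * w i * f k (y i).2) +
            ⨆ k, ∑ i, boolSign (!ε i) * w i * f k (y i).1 := by
      intro ε
      refine ciSup_le fun k => ?_
      refine le_trans (le_of_eq ?_) (add_le_add
        (le_iSup_of_abs_le (hwin ε fun i => (y i).2) k)
        (le_iSup_of_abs_le (hwin (fun i => !ε i) fun i => (y i).1) k))
      rw [← sum_add_distrib]
      refine sum_congr rfl fun i _ => ?_
      rw [boolSign_not]
      ring
    -- Negating every sign permutes the sign patterns. Hence both halves of the split are Rademacher
    -- averages, each with constant 2B.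
    have hneg : ∑ ε : ι → Bool, ⨆ k, ∑ i, boolSign (!ε i) * w i * f k (y i).1 =
        ∑ ε : ι → Bool, ⨆ k, ∑ i, boolSign (ε i) * w i * f k (y i).1 :=
      Fintype.sum_equiv (Equiv.piCongrRight fun _ => Equiv.boolNot) _ _ fun ε => rfl
    have h1 := rademacher_average_le f hB hf (fun i => (y i).1) w hv hvc
    have h2 := rademacher_average_le f hB hf (fun i => (y i).2) w hv hvc
    rw [← hR] at h1 h2
    refine (sum_le_sum fun ε _ => hsplit ε).trans ?_
    rw [sum_add_distrib, hneg]
    linarith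
  have hGε : ∀ ε : ι → Bool, Integrable (fun y =>
      ⨆ k, ∑ i, boolSign (ε i) * w i * (f k (y i).2 - f k (y i).1)) ν := fun ε =>
    integrable_of_abs_le (Measurable.iSup fun k => Finset.measurable_sum _ fun i _ =>
      Measurable.const_mul
        (((hfm k).comp (measurable_snd.comp (measurable_pi_apply i))).sub
          ((hfm k).comp (measurable_fst.comp (measurable_pi_apply i)))) _)
      fun y => abs_iSup_le (hwin' ε y)
  have hGν : ∫ y, G y ∂ν ≤ 4 * B * R := by
    have hpos : (0 : ℝ) < 2 ^ Fintype.card ι := by positivity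
    refine le_of_mul_le_mul_left ?_ hpos
    calc 2 ^ Fintype.card ι * ∫ y, G y ∂ν = ∑ _ε : ι → Bool, ∫ y, G y ∂ν := by
          simp
      _ = ∫ y, ∑ ε : ι → Bool,
            ⨆ k, ∑ i, boolSign (ε i) * w i * (f k (y i).2 - f k (y i).1) ∂ν := by
          rw [integral_finsetSum _ fun ε _ => hGε ε]
          exact sum_congr rfl fun ε _ => hswap ε
      _ ≤ ∫ _, 2 ^ Fintype.card ι * (4 * B * R) ∂ν :=
          integral_mono (integrable_finsetSum _ fun ε _ => hGε ε) (integrable_const _) hrad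
      _ = 2 ^ Fintype.card ι * (4 * B * R) := by simp
  have hGe : Integrable (fun p => G (e.symm p)) (μ.prod μ) :=
    integrable_of_abs_le (hGm.comp e.symm.measurable) fun p => hGb _
  calc ∫ S, (⨆ k, ∑ i, w i * (∫ z, f k z ∂(P i) - f k (S i))) ∂μ
      ≤ ∫ S, ∫ S', G (e.symm (S, S')) ∂μ ∂μ := by
        refine integral_mono (integrable_of_abs_le (b := b) (Measurable.iSup fun k => ?_)
          fun S => abs_iSup_le fun k => hlin _ fun i => hsub (hmean k i) (hf k _))
          hGe.integral_prod_left hghost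
        exact Finset.measurable_sum _ fun i _ => Measurable.const_mul
          (measurable_const.sub ((hfm k).comp (measurable_pi_apply i))) _
    _ = ∫ p, G (e.symm p) ∂(μ.prod μ) := (integral_prod _ hGe).symm
    _ = ∫ y, G y ∂ν := by
        rw [← hpres.map_eq, integral_map_equiv]
        simp
    _ ≤ 4 * B * R := hGν

/-! ### Gradients of convex functions -/

section Gradient

variable {F : Type*} [NormedAddCommGroup F] [InnerProductSpace ℝ F] [CompleteSpace F]

/-- On the segment from `x` to `y`, the chord slope of a convex function of one variable dominates
its initial derivative. -/
lemma inner_gradient_le_sub {f : F → ℝ} (hf : ConvexOn ℝ Set.univ f) {x : F}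
    (hd : DifferentiableAt ℝ f x) (y : F) : inner ℝ (gradient f x) (y - x) ≤ f y - f x := by
  set p : ℝ →ᵃ[ℝ] F := AffineMap.lineMap x y with hp
  have hconv : ConvexOn ℝ Set.univ (f ∘ p) := by
    have := hf.comp_affineMap p
    rwa [Set.preimage_univ] at this
  have hderiv : HasDerivAt (f ∘ p) (inner ℝ (gradient f x) (y - x)) 0 := by
    have h1 : HasFDerivAt f (fderiv ℝ f x) (p 0) := by
      simpa [hp] using hd.hasFDerivAt
    have h2 : HasDerivAt p (y - x) 0 := AffineMap.hasDerivAt_lineMap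
    rw [inner_gradient_left]
    exact h1.comp_hasDerivAt 0 h2
  have := hconv.le_slope_of_hasDerivAt (Set.mem_univ 0) (Set.mem_univ 1) one_pos hderiv
  simpa [slope_def_field, hp] using this

/-- Moving a distance `r` along the gradient raises the tangent plane by `r` times the gradient
norm, while `f` lies above that plane and can rise by at most `B`. -/
lemma norm_gradient_le_div {f : F → ℝ} (hf : ConvexOn ℝ Set.univ f) {x : F}
    (hd : DifferentiableAt ℝ f x) {r B : ℝ} (hr : 0 < r)
    (hb : ∀ y ∈ Metric.closedBall x r, f y ∈ Set.Icc 0 B) : ‖gradient f x‖ ≤ B / r := by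
  have hx := hb x (Metric.mem_closedBall_self hr.le)
  rw [le_div_iff₀ hr]
  by_cases h0 : gradient f x = 0
  · rw [h0, norm_zero, zero_mul]
    exact hx.1.trans hx.2
  have hn : 0 < ‖gradient f x‖ := norm_pos_iff.2 h0
  have hy := hb (x + (r / ‖gradient f x‖) • gradient f x) (by
    rw [Metric.mem_closedBall, dist_eq_norm, add_sub_cancel_left, norm_smul, Real.norm_eq_abs,
      abs_of_pos (div_pos hr hn), div_mul_cancel₀ _ hn.ne'])
  have h := inner_gradient_le_sub hf hd (x + (r / ‖gradient f x‖) • gradient f x)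
  rw [add_sub_cancel_left, real_inner_smul_right, real_inner_self_eq_norm_sq] at h
  have h2 : r / ‖gradient f x‖ * ‖gradient f x‖ ^ 2 = ‖gradient f x‖ * r := by
    field_simp
  rw [h2] at h
  linarith [hy.2, hx.1]

lemma hasGradientAt_sum_mul {ι : Type*} (s : Finset ι) (c : ι → ℝ) (f : ι → F → ℝ) (x : F)
    (hf : ∀ i ∈ s, DifferentiableAt ℝ (f i) x) :
    HasGradientAt (fun y => ∑ i ∈ s, c i * f i y) (∑ i ∈ s, c i • gradient (f i) x) x := by
  rw [hasGradientAt_iff_hasFDerivAt, map_sum]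
  refine HasFDerivAt.fun_sum fun i hi => ?_
  rw [map_smul, toDual_gradient]
  exact (hf i hi).hasFDerivAt.const_mul (c i)

end Gradient

/-! ### Projection -/

/-- Existence of a nearest point gives the `epsilon` term its meaning. The second part follows from
the obtuse angle at the projection between `x` and any `w` in `Θ`. -/
lemma project_spec {d : ℕ} {Θ : Set (Param d)} (hc : IsClosed Θ) (hconv : Convex ℝ Θ)
    (hne : Θ.Nonempty) (x : Param d) :
    project Θ x ∈ Θ ∧ ∀ w ∈ Θ, ‖project Θ x - w‖ ≤ ‖x - w‖ := by
  have hbdd : BddBelow (Set.range fun w : Θ => ‖x - w‖) :=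
    ⟨0, by rintro _ ⟨w, rfl⟩; exact norm_nonneg _⟩
  have hex : ∃ y, y ∈ Θ ∧ ∀ w ∈ Θ, ‖x - y‖ ≤ ‖x - w‖ := by
    obtain ⟨y, hy, h⟩ := exists_norm_eq_iInf_of_complete_convex hne hc.isComplete hconv x
    exact ⟨y, hy, fun w hw => h.le.trans (ciInf_le hbdd ⟨w, hw⟩)⟩
  obtain ⟨hmem, hmin⟩ : project Θ x ∈ Θ ∧ ∀ w ∈ Θ, ‖x - project Θ x‖ ≤ ‖x - w‖ :=
    Classical.epsilon_spec hex
  refine ⟨hmem, fun w hw => ?_⟩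
  have : Nonempty Θ := hne.to_subtype
  have heq : ‖x - project Θ x‖ = ⨅ w : Θ, ‖x - w‖ :=
    le_antisymm (le_ciInf fun w => hmin w w.2) (ciInf_le hbdd ⟨_, hmem⟩)
  have hin := (norm_eq_iInf_iff_real_inner_le_zero hconv hmem).1 heq w hw
  have hsplit : x - w = (x - project Θ x) - (w - project Θ x) := by abel
  have h2 : ‖project Θ x - w‖ ^ 2 ≤ ‖x - w‖ ^ 2 := by
    rw [hsplit, norm_sub_rev (project Θ x) w, norm_sub_sq_real (x - project Θ x)]
    nlinarith [sq_nonneg ‖x - project Θ x‖]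
  exact (sq_le_sq₀ (norm_nonneg _) (norm_nonneg _)).1 h2

/-! ### Progress of a round -/

/-- Expand the square of θ + u - w. Here `u` is the update, close to -ηk `g`, with `g` the
aggregated gradient, and `h` is the gradient to be analysed; trading `g` for `h` costs `s * D`. -/
lemma round_descent {F : Type*} [NormedAddCommGroup F] [InnerProductSpace ℝ F]
    {θ u θ' w g h : F} {η D a b s k : ℝ} (hη : 0 ≤ η) (hk : 0 ≤ k)
    (hproj : ‖θ' - w‖ ≤ ‖θ + u - w‖) (hu : ‖u + (η * k) • g‖ ≤ η ^ 2 * a) (hub : ‖u‖ ≤ η * b)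
    (hD : ‖θ - w‖ ≤ D) (hs : ‖h - g‖ ≤ s) :
    2 * (η * k) * inner ℝ h (θ - w) ≤
      ‖θ - w‖ ^ 2 - ‖θ' - w‖ ^ 2 + 2 * (η * k) * (s * D) + η ^ 2 * (2 * a * D + b ^ 2) := by
  have hηk : 0 ≤ η * k := mul_nonneg hη hk
  have h1 : ‖θ' - w‖ ^ 2 ≤ ‖θ - w‖ ^ 2 + 2 * inner ℝ (θ - w) u + ‖u‖ ^ 2 := by
    rw [← norm_add_sq_real, show θ - w + u = θ + u - w by abel]
    exact pow_le_pow_left₀ (norm_nonneg _) hproj 2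
  have h2 : ‖u‖ ^ 2 ≤ η ^ 2 * b ^ 2 := by
    rw [← mul_pow]
    exact pow_le_pow_left₀ (norm_nonneg _) hub 2
  have h3 : inner ℝ (u + (η * k) • g) (θ - w) ≤ η ^ 2 * a * D :=
    (real_inner_le_norm _ _).trans
      (mul_le_mul hu hD (norm_nonneg _) ((norm_nonneg _).trans hu))
  have h4 : inner ℝ (h - g) (θ - w) ≤ s * D :=
    (real_inner_le_norm _ _).trans
      (mul_le_mul hs hD (norm_nonneg _) ((norm_nonneg _).trans hs))
  rw [inner_add_left, real_inner_smul_left] at h3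
  rw [inner_sub_left] at h4
  rw [real_inner_comm] at h1
  have h5 := mul_le_mul_of_nonneg_left h4 hηk
  rw [mul_sub] at h5
  linarith

/-- Abel summation: after the first term, each nonnegative `a t` has coefficient q t - q (t - 1) ≤
0. The induction keeps the final term -q n a (n + 1) to absorb the next step. -/
lemma sum_mul_sub_le {q a : ℕ → ℝ} {A : ℝ} {T : ℕ} (hT : 1 ≤ T) (hq : ∀ t < T, 0 ≤ q t)
    (hanti : ∀ s t, s ≤ t → t < T → q t ≤ q s) (ha : ∀ t, 0 ≤ a t) (hA : a 0 ≤ A) :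
    ∑ t ∈ range T, q t * (a t - a (t + 1)) ≤ q 0 * A := by
  have key : ∀ n, n + 1 ≤ T →
      ∑ t ∈ range (n + 1), q t * (a t - a (t + 1)) ≤ q 0 * A - q n * a (n + 1) := by
    intro n
    induction n with
    | zero =>
      intro _
      simp only [zero_add, range_one, sum_singleton]
      have := mul_le_mul_of_nonneg_left hA (hq 0 (by omega))
      linarith
    | succ n ih =>
      intro hn
      rw [sum_range_succ]
      have h1 := ih (by omega)
      have h2 := mul_le_mul_of_nonneg_right (hanti n (n + 1) (by omega) (by omega)) (ha (n + 1))
      linarith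
  obtain ⟨n, rfl⟩ : ∃ n, T = n + 1 := ⟨T - 1, by omega⟩
  have h1 := key n le_rfl
  have h2 := mul_nonneg (hq n (by omega)) (ha (n + 1))
  linarith

/-! ### Local gradient steps -/

/-- The drift obeys d_{e+1} ≤ (1 + ηL) d_e + ηG. Bounding η by `c` in the growth factor only keeps
the result linear in η with a constant free of η. -/
lemma norm_iterate_sub_le {F : Type*} [NormedAddCommGroup F] {g : F → F}
    {L : NNReal} (hg : LipschitzWith L g) [NormedSpace ℝ F] {x : ℕ → F} {η c G : ℝ} (hη : 0 ≤ η)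
    (hηc : η ≤ c) (hx : ∀ e, x (e + 1) = x e - η • g (x e)) (hG : ‖g (x 0)‖ ≤ G) (e : ℕ) :
    ‖x e - x 0‖ ≤ η * (G * ∑ k ∈ range e, (1 + L * c) ^ k) := by
  induction e with
  | zero => simp
  | succ e ih =>
    have hG0 : 0 ≤ G := (norm_nonneg _).trans hG
    have hL : (0 : ℝ) ≤ L := L.2
    have hge : ‖g (x e)‖ ≤ G + L * ‖x e - x 0‖ := by
      have h1 := hg.dist_le_mul (x e) (x 0)
      rw [dist_eq_norm, dist_eq_norm] at h1
      have h2 := norm_add_le (g (x e) - g (x 0)) (g (x 0))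
      rw [sub_add_cancel] at h2
      linarith
    have h3 : ‖x (e + 1) - x 0‖ ≤ ‖x e - x 0‖ + η * ‖g (x e)‖ := by
      rw [hx, sub_right_comm]
      refine (norm_sub_le _ _).trans ?_
      rw [norm_smul, Real.norm_eq_abs, abs_of_nonneg hη]
    rw [geom_sum_succ]
    set K := ∑ k ∈ range e, (1 + L * c) ^ k
    have h4 := mul_le_mul_of_nonneg_left hge hη
    have h5 : η * (L * ‖x e - x 0‖) ≤ c * (L * ‖x e - x 0‖) :=
      mul_le_mul_of_nonneg_right hηc (mul_nonneg hL (norm_nonneg _))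
    have h6 := mul_le_mul_of_nonneg_left ih
      (show 0 ≤ 1 + L * c by have := mul_nonneg hL (hη.trans hηc); linarith)
    linarith

/-- Each step uses the gradient at the current iterate instead of at the start; by the Lipschitz
property and the drift bound this costs at most η · L · ηR per step. -/
lemma norm_iterate_sub_add_le {F : Type*} [NormedAddCommGroup F] {g : F → F}
    {L : NNReal} (hg : LipschitzWith L g) [NormedSpace ℝ F] {x : ℕ → F} {η R : ℝ} (hη : 0 ≤ η)
    (hx : ∀ e, x (e + 1) = x e - η • g (x e)) {E : ℕ} (hR : ∀ e < E, ‖x e - x 0‖ ≤ η * R) :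
    ‖x E - x 0 + (η * E) • g (x 0)‖ ≤ η ^ 2 * (E * (L * R)) := by
  have key : ∀ e ≤ E, ‖x e - x 0 + (η * e) • g (x 0)‖ ≤ η ^ 2 * (e * (L * R)) := by
    intro e
    induction e with
    | zero => simp
    | succ e ih =>
      intro he
      have h1 := hg.dist_le_mul (x e) (x 0)
      rw [dist_eq_norm, dist_eq_norm] at h1
      have h2 : x (e + 1) - x 0 + (η * (e + 1 : ℕ)) • g (x 0) =
          (x e - x 0 + (η * e) • g (x 0)) - η • (g (x e) - g (x 0)) := by
        rw [hx]
        push_cast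
        module
      rw [h2]
      refine (norm_sub_le _ _).trans ?_
      rw [norm_smul, Real.norm_eq_abs, abs_of_nonneg hη]
      have h3 := mul_le_mul_of_nonneg_left (h1.trans
        (mul_le_mul_of_nonneg_left (hR e (by omega)) L.2)) hη
      have h4 := ih (by omega)
      push_cast
      linarith
  exact key E le_rfl

variable {Z : Type*} {d M : ℕ}

/-! ### Assumptions on the loss and on the weights -/

/-- The loss is convex, differentiable and smooth in the parameter. -/
structure SmoothConvex (ℓ : Param d → Z → ℝ) (L : NNReal) : Prop where
  convex : ∀ z, ConvexOn ℝ Set.univ fun θ => ℓ θ z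
  differentiable : ∀ z, Differentiable ℝ fun θ => ℓ θ z
  lipschitz : ∀ z, LipschitzWith L (gradient fun θ => ℓ θ z)

/-- The weights are nonnegative and their sum is positive. -/
structure Stream.Weighted (W : Stream M) (T : ℕ) : Prop where
  wt_nonneg : ∀ m, ∀ t < T, ∀ j ∈ W.mem m t, 0 ≤ W.wt m t j
  total_pos : 0 < W.totalWeight T

/-- Boundedness of the loss controls the gradient at the centre of the ball; smoothness carries this
over all of `Θ`. -/
lemma SmoothConvex.norm_gradient_le {ℓ : Param d → Z → ℝ} {L : NNReal} (h : SmoothConvex ℓ L)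
    {Θ : Set (Param d)} {B D r : ℝ} (hr : 0 < r) (hB : ∀ θ ∈ Θ, ∀ z, ℓ θ z ∈ Set.Icc 0 B)
    (hD : ∀ x ∈ Θ, ∀ y ∈ Θ, ‖x - y‖ ≤ D) (hball : ∃ x, Metric.closedBall x r ⊆ Θ)
    {θ : Param d} (hθ : θ ∈ Θ) (z : Z) : ‖gradient (fun θ => ℓ θ z) θ‖ ≤ B / r + L * D := by
  obtain ⟨x, hx⟩ := hball
  have h1 : ‖gradient (fun θ => ℓ θ z) x‖ ≤ B / r :=
    norm_gradient_le_div (h.convex z) (h.differentiable z x) hr fun y hy => hB y (hx hy) z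
  have h2 := (h.lipschitz z).dist_le_mul θ x
  rw [dist_eq_norm, dist_eq_norm] at h2
  have h3 : (L : ℝ) * ‖θ - x‖ ≤ L * D :=
    mul_le_mul_of_nonneg_left (hD θ hθ x (hx (Metric.mem_closedBall_self hr.le))) L.2
  have h4 := norm_add_le (gradient (fun θ => ℓ θ z) θ - gradient (fun θ => ℓ θ z) x)
    (gradient (fun θ => ℓ θ z) x)
  rw [sub_add_cancel] at h4
  linarith

lemma SmoothConvex.continuous_gradient {ℓ : Param d → Z → ℝ} {L : NNReal} (h : SmoothConvex ℓ L)
    (z : Z) : Continuous (gradient fun θ => ℓ θ z) := (h.lipschitz z).continuous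

/-! ### Weighted sums of vectors -/

/-- Total weight at most 1, rather than equal to 1, accommodates memories or rounds of zero weight,
where 0/0 = 0. -/
lemma norm_sum_smul_le {ι F : Type*} [SeminormedAddCommGroup F] [NormedSpace ℝ F] {s : Finset ι}
    {c : ι → ℝ} (hc : ∀ i ∈ s, 0 ≤ c i) (hs : ∑ i ∈ s, c i ≤ 1) {y : ι → F} {b : ℝ} (hb : 0 ≤ b)
    (hy : ∀ i ∈ s, ‖y i‖ ≤ b) : ‖∑ i ∈ s, c i • y i‖ ≤ b :=
  calc ‖∑ i ∈ s, c i • y i‖ ≤ ∑ i ∈ s, c i * b := by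
        refine norm_sum_le_of_le _ fun i hi => ?_
        rw [norm_smul, Real.norm_eq_abs, abs_of_nonneg (hc i hi)]
        exact mul_le_mul_of_nonneg_left (hy i hi) (hc i hi)
    _ ≤ 1 * b := by
        rw [← sum_mul]
        exact mul_le_mul_of_nonneg_right hs hb
    _ = b := one_mul b

/-! ### Normalized weights, and risks and gradients as weighted sums -/

namespace Stream

variable {W : Stream M} {T : ℕ}

lemma Weighted.localWeight_nonneg (hW : W.Weighted T) (m : Fin M) {t : ℕ} (ht : t < T) :
    0 ≤ W.localWeight m t := sum_nonneg (hW.wt_nonneg m t ht)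

lemma Weighted.roundWeight_nonneg (hW : W.Weighted T) {t : ℕ} (ht : t < T) :
    0 ≤ W.roundWeight t := sum_nonneg fun m _ => hW.localWeight_nonneg m ht

lemma Weighted.aggWeight_nonneg (hW : W.Weighted T) (m : Fin M) {t : ℕ} (ht : t < T) :
    0 ≤ W.aggWeight m t := div_nonneg (hW.localWeight_nonneg m ht) (hW.roundWeight_nonneg ht)

lemma sum_aggWeight_le_one (W : Stream M) (t : ℕ) : ∑ m, W.aggWeight m t ≤ 1 := by
  simp only [aggWeight]
  rw [← sum_div]
  exact div_self_le_one _

lemma Weighted.memWeight_nonneg (hW : W.Weighted T) (m : Fin M) {t : ℕ} (ht : t < T)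
    {j : Fin (W.size m)} (hj : j ∈ W.mem m t) : 0 ≤ W.wt m t j / W.localWeight m t :=
  div_nonneg (hW.wt_nonneg m t ht j hj) (hW.localWeight_nonneg m ht)

lemma sum_memWeight_le_one (W : Stream M) (m : Fin M) (t : ℕ) :
    ∑ j ∈ W.mem m t, W.wt m t j / W.localWeight m t ≤ 1 := by
  rw [← sum_div]
  exact div_self_le_one _

lemma Weighted.roundImportance_nonneg (hW : W.Weighted T) {t : ℕ} (ht : t < T) :
    0 ≤ W.roundImportance T t := div_nonneg (hW.roundWeight_nonneg ht) hW.total_pos.le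

lemma Weighted.sum_roundImportance (hW : W.Weighted T) :
    ∑ t ∈ range T, W.roundImportance T t = 1 := by
  simp only [roundImportance]
  rw [← sum_div]
  exact div_self hW.total_pos.ne'

lemma Weighted.sampleImportance_nonneg (hW : W.Weighted T) (m : Fin M) (i : Fin (W.size m)) :
    0 ≤ W.sampleImportance T m i := by
  refine div_nonneg (sum_nonneg fun t ht => sum_nonneg fun j hj => ?_) hW.total_pos.le
  split_ifs
  · exact hW.wt_nonneg m t (mem_range.1 ht) j hj
  · exact le_rfl

/-- Exchanging sums collects the weights that a sample receives over the rounds. Repeated use of a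
sample thus becomes one deterministic weight, so independence across samples can be exploited. -/
lemma sum_wt_mul_div_totalWeight (W : Stream M) (T : ℕ) (m : Fin M) (g : Fin (W.size m) → ℝ) :
    (∑ t ∈ range T, ∑ j ∈ W.mem m t, W.wt m t j * g j) / W.totalWeight T =
      ∑ i, W.sampleImportance T m i * g i := by
  simp only [sampleImportance, div_mul_eq_mul_div]
  rw [← sum_div]
  congr 1
  simp only [sum_mul]
  rw [sum_comm]
  refine sum_congr rfl fun t _ => ?_
  rw [sum_comm]
  refine sum_congr rfl fun j _ => ?_
  simp

lemma empRisk_eq (W : Stream M) (ℓ : Param d → Z → ℝ) (T : ℕ) (S : W.Dataset Z) (θ : Param d) :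
    W.empRisk ℓ T S θ = ∑ m, ∑ i, W.sampleImportance T m i * ℓ θ (S m i) := by
  rw [empRisk, sum_div]
  exact sum_congr rfl fun m _ => W.sum_wt_mul_div_totalWeight T m _

lemma Weighted.sum_clientImportance (hW : W.Weighted T) :
    ∑ m, W.clientImportance T m = 1 := by
  have h : ∀ m, W.clientImportance T m =
      (∑ t ∈ range T, ∑ j ∈ W.mem m t, W.wt m t j) / W.totalWeight T := fun m => by
    rw [clientImportance]
    simpa using (W.sum_wt_mul_div_totalWeight T m fun _ => 1).symm
  rw [sum_congr rfl fun m _ => h m, ← sum_div, sum_comm]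
  exact div_self hW.total_pos.ne'

lemma Weighted.clientImportance_nonneg (hW : W.Weighted T) (m : Fin M) :
    0 ≤ W.clientImportance T m := sum_nonneg fun i _ => hW.sampleImportance_nonneg m i

lemma localRisk_eq (W : Stream M) (ℓ : Param d → Z → ℝ) (S : W.Dataset Z) (m : Fin M) (t : ℕ)
    (θ : Param d) : W.localRisk ℓ S m t θ =
      ∑ j ∈ W.mem m t, W.wt m t j / W.localWeight m t * ℓ θ (S m j) := by
  simp only [localRisk, div_mul_eq_mul_div]
  rw [sum_div]

variable {ℓ : Param d → Z → ℝ} {L : NNReal}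

lemma gradient_localRisk (hℓ : SmoothConvex ℓ L) (W : Stream M) (S : W.Dataset Z) (m : Fin M)
    (t : ℕ) (θ : Param d) : gradient (W.localRisk ℓ S m t) θ = W.localGrad ℓ S m t θ := by
  rw [show W.localRisk ℓ S m t = _ from funext (W.localRisk_eq ℓ S m t)]
  exact (hasGradientAt_sum_mul (W.mem m t) (fun j => W.wt m t j / W.localWeight m t)
    (fun j θ => ℓ θ (S m j)) θ fun j _ => hℓ.differentiable _ θ).gradient

lemma differentiable_empRisk (hℓ : SmoothConvex ℓ L) (W : Stream M) (T : ℕ) (S : W.Dataset Z) :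
    Differentiable ℝ (W.empRisk ℓ T S) := by
  rw [show W.empRisk ℓ T S = _ from funext (W.empRisk_eq ℓ T S)]
  exact Differentiable.fun_sum fun m _ => Differentiable.fun_sum fun i _ =>
    (hℓ.differentiable _).const_mul _

lemma gradient_empRisk (hℓ : SmoothConvex ℓ L) (W : Stream M) (T : ℕ) (S : W.Dataset Z)
    (θ : Param d) : gradient (W.empRisk ℓ T S) θ =
      ∑ m, ∑ i, W.sampleImportance T m i • gradient (fun θ' => ℓ θ' (S m i)) θ := by
  have h1 : W.empRisk ℓ T S = fun θ => ∑ x : (m : Fin M) × Fin (W.size m),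
      W.sampleImportance T x.1 x.2 * ℓ θ (S x.1 x.2) := by
    funext θ
    rw [W.empRisk_eq, Fintype.sum_sigma]
  rw [h1, (hasGradientAt_sum_mul univ
    (fun x : (m : Fin M) × Fin (W.size m) => W.sampleImportance T x.1 x.2)
    (fun x θ => ℓ θ (S x.1 x.2)) θ fun x _ => hℓ.differentiable _ θ).gradient, Fintype.sum_sigma]

lemma Weighted.convexOn_empRisk (hW : W.Weighted T) (hℓ : SmoothConvex ℓ L) (S : W.Dataset Z) :
    ConvexOn ℝ Set.univ (W.empRisk ℓ T S) := by
  rw [show W.empRisk ℓ T S = _ from funext (W.empRisk_eq ℓ T S)]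
  refine ⟨convex_univ, fun x _ y _ a b ha hb hab => ?_⟩
  simp only [smul_eq_mul, mul_sum]
  rw [← sum_add_distrib]
  refine sum_le_sum fun m _ => ?_
  rw [← sum_add_distrib]
  refine sum_le_sum fun i _ => ?_
  have h := (hℓ.convex (S m i)).2 (Set.mem_univ x) (Set.mem_univ y) ha hb hab
  simp only [smul_eq_mul] at h
  have := mul_le_mul_of_nonneg_left h (hW.sampleImportance_nonneg m i)
  linarith

lemma Weighted.lipschitz_localGrad (hW : W.Weighted T) (hℓ : SmoothConvex ℓ L) (S : W.Dataset Z)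
    (m : Fin M) {t : ℕ} (ht : t < T) : LipschitzWith L (W.localGrad ℓ S m t) := by
  refine LipschitzWith.of_dist_le_mul fun x y => ?_
  rw [dist_eq_norm, dist_eq_norm]
  simp only [localGrad]
  rw [← sum_sub_distrib]
  simp only [← smul_sub]
  refine norm_sum_smul_le (fun j hj => hW.memWeight_nonneg m ht hj) (W.sum_memWeight_le_one m t)
    (mul_nonneg L.2 (norm_nonneg _)) fun j _ => ?_
  have := (hℓ.lipschitz (S m j)).dist_le_mul x y
  rwa [dist_eq_norm, dist_eq_norm] at this

lemma Weighted.empRisk_mem_Icc (hW : W.Weighted T) {θ : Param d} {B : ℝ}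
    (hB : ∀ z, ℓ θ z ∈ Set.Icc 0 B) (S : W.Dataset Z) : W.empRisk ℓ T S θ ∈ Set.Icc 0 B := by
  rw [W.empRisk_eq]
  refine ⟨sum_nonneg fun m _ => sum_nonneg fun i _ =>
    mul_nonneg (hW.sampleImportance_nonneg m i) (hB _).1, ?_⟩
  calc ∑ m, ∑ i, W.sampleImportance T m i * ℓ θ (S m i)
      ≤ ∑ m, ∑ i, W.sampleImportance T m i * B :=
        sum_le_sum fun m _ => sum_le_sum fun i _ =>
          mul_le_mul_of_nonneg_left (hB _).2 (hW.sampleImportance_nonneg m i)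
    _ = (∑ m, W.clientImportance T m) * B := by
        simp only [clientImportance, sum_mul]
    _ = B := by rw [hW.sum_clientImportance, one_mul]

lemma Weighted.norm_gradient_empRisk_le (hW : W.Weighted T) (hℓ : SmoothConvex ℓ L)
    {θ : Param d} {G : ℝ} (hG0 : 0 ≤ G) (hG : ∀ z, ‖gradient (fun θ => ℓ θ z) θ‖ ≤ G)
    (S : W.Dataset Z) : ‖gradient (W.empRisk ℓ T S) θ‖ ≤ G := by
  rw [gradient_empRisk hℓ, ← Fintype.sum_sigma fun x : (m : Fin M) × Fin (W.size m) =>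
    W.sampleImportance T x.1 x.2 • gradient (fun θ' => ℓ θ' (S x.1 x.2)) θ]
  refine norm_sum_smul_le (fun x _ => hW.sampleImportance_nonneg x.1 x.2) ?_ hG0 fun x _ => hG _
  rw [Fintype.sum_sigma]
  exact hW.sum_clientImportance.le

lemma Weighted.norm_aggregated_gradient_le (hW : W.Weighted T) (hℓ : SmoothConvex ℓ L)
    {t : ℕ} (ht : t < T) {θ : Param d} {G : ℝ} (hG0 : 0 ≤ G)
    (hG : ∀ z, ‖gradient (fun θ => ℓ θ z) θ‖ ≤ G) (S : W.Dataset Z) :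
    ‖∑ m, W.aggWeight m t • gradient (W.localRisk ℓ S m t) θ‖ ≤ G := by
  refine norm_sum_smul_le (fun m _ => hW.aggWeight_nonneg m ht) (W.sum_aggWeight_le_one t) hG0
    fun m _ => ?_
  rw [gradient_localRisk hℓ]
  exact norm_sum_smul_le (fun j hj => hW.memWeight_nonneg m ht hj) (W.sum_memWeight_le_one m t)
    hG0 fun j _ => hG _

/-! ### One round and the optimization error -/

/-- Supplies `round_descent` with b = R and a = E L R; `R` bounds the local drift per unit of step
size. -/
lemma Weighted.norm_update_le (hW : W.Weighted T) (hℓ : SmoothConvex ℓ L) (S : W.Dataset Z)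
    {t : ℕ} (ht : t < T) {θ : Param d} {η c G : ℝ} (hη : 0 ≤ η) (hηc : η ≤ c) (hG0 : 0 ≤ G)
    (hG : ∀ z, ‖gradient (fun θ => ℓ θ z) θ‖ ≤ G) (E : ℕ) :
    let R := G * ∑ k ∈ range E, (1 + L * c) ^ k
    let u := ∑ m, W.aggWeight m t • (W.localIter ℓ η S m t θ E - θ)
    ‖u‖ ≤ η * R ∧
      ‖u + (η * E) • ∑ m, W.aggWeight m t • gradient (W.localRisk ℓ S m t) θ‖ ≤
        η ^ 2 * (E * (L * R)) := by
  intro R u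
  have hL : (0 : ℝ) ≤ L := L.2
  have h1 : (0 : ℝ) ≤ 1 + L * c := by
    have := mul_nonneg hL (hη.trans hηc)
    linarith
  have hR : ∀ e ≤ E, G * ∑ k ∈ range e, (1 + L * c) ^ k ≤ R := fun e he =>
    mul_le_mul_of_nonneg_left (sum_le_sum_of_subset_of_nonneg (range_subset_range.2 he)
      fun k _ _ => pow_nonneg h1 k) hG0
  have hR0 : 0 ≤ R := mul_nonneg hG0 (sum_nonneg fun k _ => pow_nonneg h1 k)
  have hGm : ∀ m, ‖W.localGrad ℓ S m t θ‖ ≤ G := fun m =>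
    norm_sum_smul_le (fun j hj => hW.memWeight_nonneg m ht hj) (W.sum_memWeight_le_one m t) hG0
      fun j _ => hG _
  have hdrift : ∀ m, ∀ e ≤ E, ‖W.localIter ℓ η S m t θ e - θ‖ ≤ η * R := fun m e he =>
    (norm_iterate_sub_le (x := W.localIter ℓ η S m t θ) (hW.lipschitz_localGrad hℓ S m ht) hη hηc
      (fun _ => rfl) (hGm m) e).trans (mul_le_mul_of_nonneg_left (hR e he) hη)
  constructor
  · exact norm_sum_smul_le (fun m _ => hW.aggWeight_nonneg m ht) (W.sum_aggWeight_le_one t)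
      (mul_nonneg hη hR0) fun m _ => hdrift m E le_rfl
  · have h2 : u + (η * E) • ∑ m, W.aggWeight m t • gradient (W.localRisk ℓ S m t) θ =
        ∑ m, W.aggWeight m t •
          (W.localIter ℓ η S m t θ E - θ + (η * E) • W.localGrad ℓ S m t θ) := by
      simp only [u, smul_sum, gradient_localRisk hℓ]
      rw [← sum_add_distrib]
      refine sum_congr rfl fun m _ => ?_
      rw [smul_add, smul_comm]
    rw [h2]
    have h3 : ∀ m, ‖W.localIter ℓ η S m t θ E - θ + (η * E) • W.localGrad ℓ S m t θ‖ ≤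
        η ^ 2 * (E * (L * R)) := fun m =>
      norm_iterate_sub_add_le (x := W.localIter ℓ η S m t θ) (hW.lipschitz_localGrad hℓ S m ht) hη
        (fun _ => rfl) fun e he => hdrift m e he.le
    exact norm_sum_smul_le (fun m _ => hW.aggWeight_nonneg m ht) (W.sum_aggWeight_le_one t)
      (mul_nonneg (sq_nonneg η) (mul_nonneg (Nat.cast_nonneg E) (mul_nonneg hL hR0)))
      fun m _ => h3 m

lemma globalIter_mem {Θ : Set (Param d)} (hc : IsClosed Θ) (hconv : Convex ℝ Θ) {θ₀ : Param d}
    (hθ₀ : θ₀ ∈ Θ) (W : Stream M) (ℓ : Param d → Z → ℝ) (E : ℕ) (η : ℝ) (S : W.Dataset Z)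
    (t : ℕ) : W.globalIter ℓ Θ E η θ₀ S t ∈ Θ := by
  cases t with
  | zero => exact hθ₀
  | succ t => exact (project_spec hc hconv ⟨θ₀, hθ₀⟩ _).1

lemma Weighted.output_mem (hW : W.Weighted T) {Θ : Set (Param d)} (hc : IsClosed Θ)
    (hconv : Convex ℝ Θ) {θ₀ : Param d} (hθ₀ : θ₀ ∈ Θ) (E : ℕ) (η : ℝ) (S : W.Dataset Z) :
    W.output ℓ Θ E η θ₀ T S ∈ Θ :=
  hconv.sum_mem (fun _ ht => hW.roundImportance_nonneg (mem_range.1 ht)) hW.sum_roundImportance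
    fun _ _ => globalIter_mem hc hconv hθ₀ W ℓ E η S _

/-- The optimization error on a fixed dataset. -/
theorem Weighted.optimization_error_le (hW : W.Weighted T) (hT : 1 ≤ T) (hℓ : SmoothConvex ℓ L)
    {Θ : Set (Param d)} (hc : IsClosed Θ) (hconv : Convex ℝ Θ) {D : ℝ}
    (hD : ∀ x ∈ Θ, ∀ y ∈ Θ, ‖x - y‖ ≤ D) {G : ℝ} (hG0 : 0 ≤ G)
    (hG : ∀ θ ∈ Θ, ∀ z, ‖gradient (fun θ => ℓ θ z) θ‖ ≤ G)
    (hq : ∀ s t, s ≤ t → t < T → W.roundImportance T t ≤ W.roundImportance T s)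
    {θ₀ w : Param d} (hθ₀ : θ₀ ∈ Θ) (hw : w ∈ Θ) {η c : ℝ} (hη : 0 < η) (hηc : η ≤ c)
    {E : ℕ} (hE : 1 ≤ E) (S : W.Dataset Z) (s : ℕ → ℝ)
    (hs : ∀ t < T, ∀ θ ∈ Θ, ‖gradient (W.empRisk ℓ T S) θ -
      ∑ m, W.aggWeight m t • gradient (W.localRisk ℓ S m t) θ‖ ≤ s t) :
    let R := G * ∑ k ∈ range E, (1 + L * c) ^ k
    W.empRisk ℓ T S (W.output ℓ Θ E η θ₀ T S) - W.empRisk ℓ T S w ≤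
      W.roundImportance T 0 * D ^ 2 / (2 * (η * E)) +
        D * ∑ t ∈ range T, W.roundImportance T t * s t +
        η * ((2 * (E * (L * R)) * D + R ^ 2) / (2 * E)) := by
  intro R
  set x := W.globalIter ℓ Θ E η θ₀ S with hx
  set f := W.empRisk ℓ T S with hf
  set q := W.roundImportance T with hqdef
  have hmem : ∀ t, x t ∈ Θ := fun t => globalIter_mem hc hconv hθ₀ W ℓ E η S t
  have hE0 : (0 : ℝ) < E := by exact_mod_cast hE
  have hround : ∀ t < T, 2 * (η * E) * (f (x t) - f w) ≤
      ‖x t - w‖ ^ 2 - ‖x (t + 1) - w‖ ^ 2 + 2 * (η * E) * (s t * D) +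
        η ^ 2 * (2 * (E * (L * R)) * D + R ^ 2) := by
    intro t ht
    obtain ⟨h1, h2⟩ := hW.norm_update_le hℓ S ht hη.le hηc hG0 (hG _ (hmem t)) E
    refine le_trans ?_ (round_descent hη.le hE0.le
      ((project_spec hc hconv ⟨θ₀, hθ₀⟩ _).2 w hw) h2 h1 (hD _ (hmem t) _ hw)
      (hs t ht _ (hmem t)))
    refine mul_le_mul_of_nonneg_left ?_ (by positivity)
    have := inner_gradient_le_sub (hW.convexOn_empRisk hℓ S)
      (differentiable_empRisk hℓ W T S (x t)) w
    rw [← neg_sub, inner_neg_right] at this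
    linarith
  -- The output averages the iterates with the same weights q^(t) that multiply the round
  -- inequalities.
  have hjensen : f (W.output ℓ Θ E η θ₀ T S) ≤ ∑ t ∈ range T, q t * f (x t) :=
    (hW.convexOn_empRisk hℓ S).map_sum_le
      (fun t ht => hW.roundImportance_nonneg (mem_range.1 ht)) hW.sum_roundImportance
      fun _ _ => Set.mem_univ _
  have hsum := sum_le_sum fun t (ht : t ∈ range T) =>
    mul_le_mul_of_nonneg_left (hround t (mem_range.1 ht))
      (hW.roundImportance_nonneg (mem_range.1 ht))
  have habel := sum_mul_sub_le (a := fun t => ‖x t - w‖ ^ 2) (A := D ^ 2) hT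
    (fun _ ht => hW.roundImportance_nonneg ht) hq (fun _ => by positivity)
    (pow_le_pow_left₀ (norm_nonneg _) (hD _ (hmem 0) _ hw) 2)
  have hleft : ∑ t ∈ range T, q t * (2 * (η * E) * (f (x t) - f w)) =
      2 * (η * E) * (∑ t ∈ range T, q t * f (x t) - f w) := by
    have : f w = ∑ t ∈ range T, q t * f w := by rw [← sum_mul, hW.sum_roundImportance, one_mul]
    rw [this, ← sum_sub_distrib, mul_sum, ← this]
    exact sum_congr rfl fun t _ => by ring
  set C := 2 * (E * (L * R)) * D + R ^ 2 with hC
  have hright : ∑ t ∈ range T, q t * (‖x t - w‖ ^ 2 - ‖x (t + 1) - w‖ ^ 2 +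
      2 * (η * E) * (s t * D) + η ^ 2 * C) =
      ∑ t ∈ range T, q t * (‖x t - w‖ ^ 2 - ‖x (t + 1) - w‖ ^ 2) +
        2 * (η * E) * (D * ∑ t ∈ range T, q t * s t) + η ^ 2 * C := by
    have : η ^ 2 * C = ∑ t ∈ range T, q t * (η ^ 2 * C) := by
      rw [← sum_mul, hW.sum_roundImportance, one_mul]
    rw [this, mul_sum, mul_sum, ← sum_add_distrib, ← sum_add_distrib, ← this]
    exact sum_congr rfl fun t _ => by ring
  rw [hleft, hright] at hsum
  have hpos : 0 < 2 * (η * E) := by positivity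
  refine (sub_le_sub_right hjensen _).trans (le_of_mul_le_mul_left ?_ hpos)
  refine (hsum.trans (add_le_add_left (add_le_add_left habel _) _)).trans (le_of_eq ?_)
  field_simp
  ring

end Stream

/-! ### Degenerate classes -/

lemma vcDim_mono {β : Type*} {C C' : Set (Set β)} (h : C ⊆ C') : vcDim C ≤ vcDim C' :=
  iSup₂_le fun s hs => le_iSup₂ (f := fun (s : Finset β) (_ : Shatters C' s) => (s.card : ℕ∞)) s
    fun t ht => (hs t ht).imp fun _ hA => ⟨h hA.1, hA.2⟩

/-- If f k z < f k' z, the point (z, f k z) lies in the subgraph of `k'` but not in that of `k`, so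
a singleton is shattered. -/
lemma eq_of_vcDim_le_zero {K Z : Type*} {f : K → Z → ℝ}
    (h : vcDim (Set.range fun k => {y : Z × ℝ | y.2 < f k y.1}) ≤ 0) (k k' : K) (z : Z) :
    f k z = f k' z := by
  by_contra hne
  wlog hlt : f k z < f k' z generalizing k k'
  · exact this k' k (Ne.symm hne) (lt_of_le_of_ne (not_lt.1 hlt) (Ne.symm hne))
  have hsh : Shatters (Set.range fun k => {y : Z × ℝ | y.2 < f k y.1}) {(z, f k z)} := by
    intro t ht
    rcases subset_singleton_iff.1 ht with rfl | rfl
    · exact ⟨_, ⟨k, rfl⟩, by ext y; simp⟩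
    · refine ⟨_, ⟨k', rfl⟩, ?_⟩
      ext y
      simp only [coe_singleton, Set.mem_inter_iff, Set.mem_singleton_iff, Set.mem_ofPred_eq,
        and_iff_left_iff_imp]
      rintro rfl
      exact hlt
  have :=
    (le_iSup₂ (f := fun (s : Finset (Z × ℝ)) (_ : Shatters _ s) => (s.card : ℕ∞)) _ hsh).trans h
  simp at this

/-- The expected supremum of the deviations of weighted averages from their means, including the
case of VC dimension zero. -/
theorem integral_iSup_deviation_le_of_vcDim_le {ι K Z : Type*} [Fintype ι] [Countable K]
    [Nonempty K] [MeasurableSpace Z] (P : ι → Measure Z) [∀ i, IsProbabilityMeasure (P i)]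
    (f : K → Z → ℝ) (hfm : ∀ k, Measurable (f k)) {B : ℝ} (hB : 0 ≤ B)
    (hf : ∀ k z, f k z ∈ Set.Icc 0 B) (w : ι → ℝ) {v : ℕ}
    (hvc : vcDim (Set.range fun k => {y : Z × ℝ | y.2 < f k y.1}) ≤ v) :
    ∫ S, (⨆ k, ∑ i, w i * (∫ z, f k z ∂(P i) - f k (S i))) ∂(Measure.pi P) ≤
      4 * B * Real.sqrt (v * (1 + Real.posLog (Fintype.card ι / v)) * ∑ i, w i ^ 2) := by
  -- For v = 0 the right side is 0, so the expectation must be bounded exactly: all functions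
  -- coincide and the deviation is centred.
  rcases Nat.eq_zero_or_pos v with rfl | hv
  · obtain ⟨k₀⟩ := (inferInstance : Nonempty K)
    have heq : ∀ k, f k = f k₀ := fun k =>
      funext fun z => eq_of_vcDim_le_zero (by exact_mod_cast hvc) k k₀ z
    have hfint : ∀ i, Integrable (f k₀) (P i) := fun i =>
      integrable_of_abs_le (hfm k₀) fun z => by
        rw [abs_of_nonneg (hf k₀ z).1]
        exact (hf k₀ z).2
    have hcoord : ∀ i, Integrable (fun S : ι → Z => f k₀ (S i)) (Measure.pi P) := fun i =>
      ((measurePreserving_eval P i).integrable_comp (hfm k₀).aestronglyMeasurable).2 (hfint i)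
    have hint : ∀ i ∈ (univ : Finset ι), Integrable
        (fun S : ι → Z => w i * (∫ z, f k₀ z ∂(P i) - f k₀ (S i))) (Measure.pi P) := fun i _ =>
      ((integrable_const _).sub (hcoord i)).const_mul _
    have hzero : ∫ S, (⨆ k, ∑ i, w i * (∫ z, f k z ∂(P i) - f k (S i))) ∂(Measure.pi P) = 0 := by
      simp only [heq, ciSup_const]
      rw [integral_finsetSum _ hint]
      refine sum_eq_zero fun i _ => ?_
      rw [integral_const_mul, integral_sub (integrable_const _) (hcoord i), integral_const]
      have h1 : ∫ S : ι → Z, f k₀ (S i) ∂(Measure.pi P) = ∫ z, f k₀ z ∂(P i) := by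
        rw [← (measurePreserving_eval P i).map_eq,
          integral_map (measurable_pi_apply i).aemeasurable (hfm k₀).aestronglyMeasurable]
      rw [h1]
      simp
    rw [hzero]
    positivity
  · exact integral_iSup_deviation_le P f hfm hB hf w hv hvc

/-! ### Measurability -/

/-- Continuity in the parameter turns suprema over `Θ` into countable ones, for measurability and
for the symmetrization bound. -/
lemma iSup_denseSeq_eq {X : Type*} [TopologicalSpace X] [TopologicalSpace.SeparableSpace X]
    [Nonempty X] {g : X → ℝ} (hg : Continuous g) {b : ℝ} (hb : ∀ x, |g x| ≤ b) :
    ⨆ x, g x = ⨆ n, g (TopologicalSpace.denseSeq X n) := by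
  have hb' : ∀ n, |g (TopologicalSpace.denseSeq X n)| ≤ b := fun n => hb _
  refine le_antisymm (ciSup_le fun x => ?_) (ciSup_le fun n => le_iSup_of_abs_le hb _)
  have hclosed : IsClosed {x | g x ≤ ⨆ n, g (TopologicalSpace.denseSeq X n)} :=
    isClosed_le hg continuous_const
  have hsub : Set.range (TopologicalSpace.denseSeq X) ⊆
      {x | g x ≤ ⨆ n, g (TopologicalSpace.denseSeq X n)} := by
    rintro _ ⟨n, rfl⟩
    exact le_iSup_of_abs_le hb' n
  exact hclosed.closure_subset_iff.2 hsub (TopologicalSpace.denseRange_denseSeq X x)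

lemma measurable_iSup_of_continuous {X Ω : Type*} [TopologicalSpace X]
    [TopologicalSpace.SeparableSpace X] [Nonempty X] [MeasurableSpace Ω] {g : X → Ω → ℝ}
    (hc : ∀ ω, Continuous fun x => g x ω) (hm : ∀ x, Measurable (g x)) {b : ℝ}
    (hb : ∀ x ω, |g x ω| ≤ b) : Measurable fun ω => ⨆ x, g x ω := by
  simp only [fun ω => iSup_denseSeq_eq (hc ω) fun x => hb x ω]
  exact Measurable.iSup fun n => hm _

variable {Z : Type*} {d M : ℕ} [MeasurableSpace Z]

/-- Directional derivatives are limits of difference quotients at scale 1/n. The shifted points may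
leave `Θ`, so measurability of the loss is used at every parameter. -/
lemma SmoothConvex.measurable_gradient {ℓ : Param d → Z → ℝ} {L : NNReal} (h : SmoothConvex ℓ L)
    (hm : ∀ θ, Measurable (ℓ θ)) (θ : Param d) :
    Measurable fun z => gradient (fun θ => ℓ θ z) θ := by
  have hcoord : ∀ e : Param d, Measurable fun z => fderiv ℝ (fun θ => ℓ θ z) θ e := by
    intro e
    refine measurable_of_tendsto_metrizable
      (f := fun (n : ℕ) z => (n : ℝ) • (ℓ (θ + (n : ℝ)⁻¹ • e) z - ℓ θ z))
      (fun n => ((hm _).sub (hm _)).const_mul (n : ℝ)) ?_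
    rw [tendsto_pi_nhds]
    exact fun z => ((h.differentiable z θ).hasFDerivAt.lim_real e).comp tendsto_natCast_atTop_atTop
  have hsum : ∀ z, gradient (fun θ => ℓ θ z) θ =
      ∑ i, fderiv ℝ (fun θ => ℓ θ z) θ (EuclideanSpace.basisFun (Fin d) ℝ i) •
        EuclideanSpace.basisFun (Fin d) ℝ i := by
    intro z
    rw [← (EuclideanSpace.basisFun (Fin d) ℝ).sum_repr' (gradient (fun θ => ℓ θ z) θ)]
    refine sum_congr rfl fun i _ => ?_
    rw [real_inner_comm, inner_gradient_left]
  simp only [hsum]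
  exact Finset.measurable_sum _ fun i _ => (hcoord _).smul_const _

/-! ### The law of the dataset -/

namespace Stream

variable {W : Stream M} {T : ℕ}

/-- Flattens the nested product over clients and samples into one product over pairs, the form
needed for symmetrization. -/
lemma map_piCurry_pi_eq_dataLaw (W : Stream M) (P : Fin M → Measure Z)
    [∀ m, IsProbabilityMeasure (P m)] :
    (Measure.pi fun x : (m : Fin M) × Fin (W.size m) => P x.1).map
      (MeasurableEquiv.piCurry fun _ _ => Z) = W.dataLaw P := by
  have := Measure.infinitePi_map_piCurry (X := fun (m : Fin M) (_ : Fin (W.size m)) => Z)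
    (fun m _ => P m)
  simp only [Measure.infinitePi_eq_pi] at this
  exact this

instance isProbabilityMeasure_dataLaw (W : Stream M) (P : Fin M → Measure Z)
    [∀ m, IsProbabilityMeasure (P m)] : IsProbabilityMeasure (W.dataLaw P) := by
  unfold dataLaw
  infer_instance

lemma measurePreserving_sample (W : Stream M) (P : Fin M → Measure Z)
    [∀ m, IsProbabilityMeasure (P m)] (m : Fin M) (i : Fin (W.size m)) :
    MeasurePreserving (fun S : W.Dataset Z => S m i) (W.dataLaw P) (P m) :=
  (measurePreserving_eval (fun _ : Fin (W.size m) => P m) i).comp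
    (measurePreserving_eval (fun m => Measure.pi fun _ : Fin (W.size m) => P m) m)

lemma measurable_sample (W : Stream M) (m : Fin M) (i : Fin (W.size m)) :
    Measurable fun S : W.Dataset Z => S m i :=
  (measurable_pi_apply i).comp (measurable_pi_apply m)

end Stream

/-! ### Risks -/

section Risk

variable {ℓ : Param d → Z → ℝ} {P : Fin M → Measure Z} [∀ m, IsProbabilityMeasure (P m)] {B : ℝ}

lemma integrable_loss (hm : ∀ θ, Measurable (ℓ θ)) {θ : Param d}
    (hB : ∀ z, ℓ θ z ∈ Set.Icc 0 B) (Q : Measure Z) [IsFiniteMeasure Q] : Integrable (ℓ θ) Q :=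
  integrable_of_abs_le (hm θ) fun z => by
    rw [abs_of_nonneg (hB z).1]
    exact (hB z).2

lemma risk_mem_Icc (hm : ∀ θ, Measurable (ℓ θ)) {θ : Param d}
    (hB : ∀ z, ℓ θ z ∈ Set.Icc 0 B) (Q : Measure Z) [IsProbabilityMeasure Q] :
    risk ℓ Q θ ∈ Set.Icc 0 B := by
  refine ⟨integral_nonneg fun z => (hB z).1, ?_⟩
  calc risk ℓ Q θ ≤ ∫ _, B ∂Q :=
        integral_mono (integrable_loss hm hB Q) (integrable_const _) fun z => (hB z).2
    _ = B := by simp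

lemma risk_mixture (hm : ∀ θ, Measurable (ℓ θ)) {θ : Param d}
    (hB : ∀ z, ℓ θ z ∈ Set.Icc 0 B) {a : Fin M → ℝ} (ha : ∀ m, 0 ≤ a m) :
    risk ℓ (mixture P a) θ = ∑ m, a m * risk ℓ (P m) θ := by
  rw [risk, mixture, integral_finsetSum_measure fun m _ =>
    (integrable_loss hm hB (P m)).smul_measure ENNReal.ofReal_ne_top]
  refine sum_congr rfl fun m _ => ?_
  rw [integral_smul_measure, ENNReal.toReal_ofReal (ha m), smul_eq_mul, risk]

lemma isProbabilityMeasure_mixture {a : Fin M → ℝ} (ha : ∀ m, 0 ≤ a m) (h1 : ∑ m, a m = 1) :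
    IsProbabilityMeasure (mixture P a) := by
  constructor
  rw [mixture, Measure.finsetSum_apply]
  simp only [Measure.smul_apply, measure_univ, smul_eq_mul, mul_one]
  rw [← ENNReal.ofReal_sum_of_nonneg fun m _ => ha m, h1, ENNReal.ofReal_one]

lemma abs_risk_sub_risk_le_disc (hm : ∀ θ, Measurable (ℓ θ)) {Θ : Set (Param d)}
    (hB : ∀ θ ∈ Θ, ∀ z, ℓ θ z ∈ Set.Icc 0 B) (Q Q' : Measure Z) [IsProbabilityMeasure Q]
    [IsProbabilityMeasure Q'] {θ : Param d} (hθ : θ ∈ Θ) :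
    |risk ℓ Q θ - risk ℓ Q' θ| ≤ disc ℓ Θ Q Q' := by
  refine le_iSup_of_abs_le (g := fun θ : Θ => |risk ℓ Q θ - risk ℓ Q' θ|) (b := B)
    (fun θ => ?_) ⟨θ, hθ⟩
  have h1 := risk_mem_Icc hm (hB θ θ.2) Q
  have h2 := risk_mem_Icc hm (hB θ θ.2) Q'
  rw [abs_abs, abs_le]
  constructor <;> linarith [h1.1, h1.2, h2.1, h2.2]

lemma SmoothConvex.continuous_risk {L : NNReal} (h : SmoothConvex ℓ L)
    (hm : ∀ θ, Measurable (ℓ θ)) {Θ : Set (Param d)} (hB : ∀ θ ∈ Θ, ∀ z, ℓ θ z ∈ Set.Icc 0 B)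
    (Q : Measure Z) [IsFiniteMeasure Q] : Continuous fun θ : Θ => risk ℓ Q θ := by
  refine continuous_of_dominated (bound := fun _ => B) (fun θ => (hm θ).aestronglyMeasurable)
    (fun θ => Filter.Eventually.of_forall fun z => ?_) (integrable_const _)
    (Filter.Eventually.of_forall fun z =>
      (h.differentiable z).continuous.comp continuous_subtype_val)
  rw [Real.norm_eq_abs, abs_of_nonneg (hB θ θ.2 z).1]
  exact (hB θ θ.2 z).2

end Risk

namespace Stream

variable {W : Stream M} {T : ℕ} {ℓ : Param d → Z → ℝ} {L : NNReal} {P : Fin M → Measure Z}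
  [∀ m, IsProbabilityMeasure (P m)] {B : ℝ} {Θ : Set (Param d)}

lemma measurable_empRisk (hm : ∀ θ, Measurable (ℓ θ)) (W : Stream M) (T : ℕ) (θ : Param d) :
    Measurable fun S : W.Dataset Z => W.empRisk ℓ T S θ := by
  simp only [W.empRisk_eq]
  exact Finset.measurable_sum _ fun m _ => Finset.measurable_sum _ fun i _ =>
    ((hm θ).comp (W.measurable_sample m i)).const_mul _

lemma Weighted.risk_mixture_clientImportance (hW : W.Weighted T) (hm : ∀ θ, Measurable (ℓ θ))
    {θ : Param d} (hB : ∀ z, ℓ θ z ∈ Set.Icc 0 B) :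
    risk ℓ (mixture P (W.clientImportance T)) θ =
      ∑ m, ∑ i, W.sampleImportance T m i * risk ℓ (P m) θ := by
  rw [risk_mixture hm hB hW.clientImportance_nonneg]
  exact sum_congr rfl fun m _ => by rw [clientImportance, sum_mul]

lemma Weighted.integrable_empRisk (hW : W.Weighted T) (hm : ∀ θ, Measurable (ℓ θ)) {θ : Param d}
    (hB : ∀ z, ℓ θ z ∈ Set.Icc 0 B) :
    Integrable (fun S => W.empRisk ℓ T S θ) (W.dataLaw P) :=
  integrable_of_abs_le (measurable_empRisk hm W T θ) fun S => by
    rw [abs_of_nonneg (hW.empRisk_mem_Icc hB S).1]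
    exact (hW.empRisk_mem_Icc hB S).2

lemma Weighted.integral_empRisk (hW : W.Weighted T) (hm : ∀ θ, Measurable (ℓ θ)) {θ : Param d}
    (hB : ∀ z, ℓ θ z ∈ Set.Icc 0 B) :
    ∫ S, W.empRisk ℓ T S θ ∂(W.dataLaw P) = risk ℓ (mixture P (W.clientImportance T)) θ := by
  have hint : ∀ m i, Integrable (fun S : W.Dataset Z => W.sampleImportance T m i * ℓ θ (S m i))
      (W.dataLaw P) := fun m i =>
    (((W.measurePreserving_sample P m i).integrable_comp
      (hm θ).aestronglyMeasurable).2 (integrable_loss hm hB (P m))).const_mul _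
  rw [hW.risk_mixture_clientImportance hm hB]
  simp only [W.empRisk_eq]
  rw [integral_finsetSum _ fun m _ => integrable_finsetSum _ fun i _ => hint m i]
  refine sum_congr rfl fun m _ => ?_
  rw [integral_finsetSum _ fun i _ => hint m i]
  refine sum_congr rfl fun i _ => ?_
  rw [integral_const_mul, risk, ← (W.measurePreserving_sample P m i).map_eq,
    integral_map (W.measurable_sample m i).aemeasurable (hm θ).aestronglyMeasurable]

/-- The expected uniform deviation of the empirical risk from the risk. -/
theorem Weighted.integral_iSup_risk_sub_empRisk_le (hW : W.Weighted T)
    (hℓ : SmoothConvex ℓ L) (hm : ∀ θ, Measurable (ℓ θ)) (hne : Θ.Nonempty) (hB0 : 0 ≤ B)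
    (hB : ∀ θ ∈ Θ, ∀ z, ℓ θ z ∈ Set.Icc 0 B) {v : ℕ} (hv : hypothesisVCDim ℓ Θ ≤ v) :
    ∫ S, (⨆ θ : Θ, (risk ℓ (mixture P (W.clientImportance T)) θ - W.empRisk ℓ T S θ))
        ∂(W.dataLaw P) ≤
      4 * B * (Real.sqrt (v / W.effSamples T) *
        Real.sqrt (1 + Real.posLog (W.numSamples / v))) := by
  have : Nonempty Θ := hne.to_subtype
  have := isProbabilityMeasure_mixture (P := P) hW.clientImportance_nonneg hW.sum_clientImportance
  set x := TopologicalSpace.denseSeq Θ with hx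
  have hdense : ∀ S : W.Dataset Z,
      ⨆ θ : Θ, (risk ℓ (mixture P (W.clientImportance T)) θ - W.empRisk ℓ T S θ) =
      ⨆ k, (risk ℓ (mixture P (W.clientImportance T)) (x k) - W.empRisk ℓ T S (x k)) := fun S =>
    iSup_denseSeq_eq (g := fun θ : Θ =>
        risk ℓ (mixture P (W.clientImportance T)) θ - W.empRisk ℓ T S θ) (b := B)
      ((hℓ.continuous_risk hm hB _).sub
        ((differentiable_empRisk hℓ W T S).continuous.comp continuous_subtype_val))
      fun θ => by
        have h1 := risk_mem_Icc hm (hB θ θ.2) (mixture P (W.clientImportance T))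
        have h2 := hW.empRisk_mem_Icc (hB θ θ.2) S
        rw [abs_le]
        constructor <;> linarith [h1.1, h1.2, h2.1, h2.2]
  have hflat : ∀ (y : (m : Fin M) × Fin (W.size m) → Z) k,
      risk ℓ (mixture P (W.clientImportance T)) (x k) -
        W.empRisk ℓ T (MeasurableEquiv.piCurry (fun _ _ => Z) y) (x k) =
      ∑ i : (m : Fin M) × Fin (W.size m), W.sampleImportance T i.1 i.2 *
        (∫ z, ℓ (x k) z ∂(P i.1) - ℓ (x k) (y i)) := by
    intro y k
    rw [hW.risk_mixture_clientImportance hm (hB _ (x k).2), W.empRisk_eq, Fintype.sum_sigma,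
      ← sum_sub_distrib]
    refine sum_congr rfl fun m _ => ?_
    rw [← sum_sub_distrib]
    refine sum_congr rfl fun i _ => ?_
    rw [mul_sub]
    rfl
  have hvc : vcDim (Set.range fun k => {y : Z × ℝ | y.2 < ℓ (x k) y.1}) ≤ v := by
    refine (vcDim_mono ?_).trans hv
    rintro _ ⟨k, rfl⟩
    exact ⟨x k, (x k).2, rfl⟩
  have hmain := integral_iSup_deviation_le_of_vcDim_le
    (fun i : (m : Fin M) × Fin (W.size m) => P i.1) (fun k => ℓ (x k)) (fun k => hm _) hB0
    (fun k => hB _ (x k).2) (fun i => W.sampleImportance T i.1 i.2) hvc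
  simp only [hdense]
  rw [← W.map_piCurry_pi_eq_dataLaw P, integral_map_equiv]
  simp only [hflat]
  refine hmain.trans (le_of_eq ?_)
  -- The pairs (client, sample) number N, and their squared weights sum to 1/N_eff.
  rw [Fintype.card_sigma, Fintype.sum_sigma, ← Real.sqrt_mul (by rw [effSamples]; positivity),
    effSamples, div_inv_eq_mul, numSamples]
  simp only [Fintype.card_fin]
  congr 2
  ring

end Stream

/-! ### Gradient variability -/

namespace Stream

variable {Z : Type*} {d M : ℕ} {W : Stream M} {T : ℕ} {ℓ : Param d → Z → ℝ} {L : NNReal}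
  {Θ : Set (Param d)}

/-- The largest squared distance, over the domain, between the gradient of the global weighted
empirical risk and the aggregated gradient of a round. -/
noncomputable def sqGradGap (W : Stream M) (ℓ : Param d → Z → ℝ) (Θ : Set (Param d)) (T t : ℕ)
    (S : W.Dataset Z) : ℝ :=
  ⨆ θ : Θ, ‖gradient (W.empRisk ℓ T S) (θ : Param d) -
    ∑ m, W.aggWeight m t • gradient (W.localRisk ℓ S m t) (θ : Param d)‖ ^ 2

lemma Weighted.sq_norm_gradient_sub_le (hW : W.Weighted T) (hℓ : SmoothConvex ℓ L) {t : ℕ}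
    (ht : t < T) {θ : Param d} {G : ℝ} (hG0 : 0 ≤ G)
    (hG : ∀ z, ‖gradient (fun θ => ℓ θ z) θ‖ ≤ G) (S : W.Dataset Z) :
    |‖gradient (W.empRisk ℓ T S) θ -
      ∑ m, W.aggWeight m t • gradient (W.localRisk ℓ S m t) θ‖ ^ 2| ≤ (G + G) ^ 2 := by
  rw [abs_of_nonneg (sq_nonneg _)]
  exact pow_le_pow_left₀ (norm_nonneg _) ((norm_sub_le _ _).trans
    (add_le_add (hW.norm_gradient_empRisk_le hℓ hG0 hG S)
      (hW.norm_aggregated_gradient_le hℓ ht hG0 hG S))) 2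

lemma Weighted.abs_sqGradGap_le (hW : W.Weighted T) (hℓ : SmoothConvex ℓ L) {t : ℕ} (ht : t < T)
    (hne : Θ.Nonempty) {G : ℝ} (hG0 : 0 ≤ G)
    (hG : ∀ θ ∈ Θ, ∀ z, ‖gradient (fun θ => ℓ θ z) θ‖ ≤ G) (S : W.Dataset Z) :
    |W.sqGradGap ℓ Θ T t S| ≤ (G + G) ^ 2 := by
  have : Nonempty Θ := hne.to_subtype
  exact abs_iSup_le fun θ => hW.sq_norm_gradient_sub_le hℓ ht hG0 (hG θ θ.2) S

lemma sqGradGap_nonneg (W : Stream M) (ℓ : Param d → Z → ℝ) (Θ : Set (Param d)) (T t : ℕ)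
    (S : W.Dataset Z) : 0 ≤ W.sqGradGap ℓ Θ T t S :=
  Real.iSup_nonneg fun _ => sq_nonneg _

lemma Weighted.norm_gradient_sub_le_sqrt (hW : W.Weighted T) (hℓ : SmoothConvex ℓ L) {t : ℕ}
    (ht : t < T) {G : ℝ} (hG0 : 0 ≤ G) (hG : ∀ θ ∈ Θ, ∀ z, ‖gradient (fun θ => ℓ θ z) θ‖ ≤ G)
    (S : W.Dataset Z) {θ : Param d} (hθ : θ ∈ Θ) :
    ‖gradient (W.empRisk ℓ T S) θ -
      ∑ m, W.aggWeight m t • gradient (W.localRisk ℓ S m t) θ‖ ≤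
        Real.sqrt (W.sqGradGap ℓ Θ T t S) := by
  refine Real.le_sqrt_of_sq_le ?_
  exact le_iSup_of_abs_le (g := fun θ : Θ => ‖gradient (W.empRisk ℓ T S) (θ : Param d) -
    ∑ m, W.aggWeight m t • gradient (W.localRisk ℓ S m t) (θ : Param d)‖ ^ 2)
    (fun θ => hW.sq_norm_gradient_sub_le hℓ ht hG0 (hG θ θ.2) S) ⟨θ, hθ⟩

variable [MeasurableSpace Z]

lemma Weighted.measurable_sqGradGap (hW : W.Weighted T) (hℓ : SmoothConvex ℓ L)
    (hm : ∀ θ, Measurable (ℓ θ)) {t : ℕ} (ht : t < T) (hne : Θ.Nonempty) {G : ℝ} (hG0 : 0 ≤ G)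
    (hG : ∀ θ ∈ Θ, ∀ z, ‖gradient (fun θ => ℓ θ z) θ‖ ≤ G) :
    Measurable (W.sqGradGap ℓ Θ T t) := by
  have : Nonempty Θ := hne.to_subtype
  refine measurable_iSup_of_continuous (g := fun (θ : Θ) S =>
    ‖gradient (W.empRisk ℓ T S) (θ : Param d) -
      ∑ m, W.aggWeight m t • gradient (W.localRisk ℓ S m t) (θ : Param d)‖ ^ 2)
    (fun S => ?_) (fun θ => ?_) fun θ S => hW.sq_norm_gradient_sub_le hℓ ht hG0 (hG θ θ.2) S
  · simp only [gradient_empRisk hℓ, gradient_localRisk hℓ, localGrad]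
    have hgc : ∀ z, Continuous fun θ : Θ => gradient (fun θ => ℓ θ z) (θ : Param d) := fun z =>
      (hℓ.continuous_gradient z).comp continuous_subtype_val
    refine ((Continuous.sub ?_ ?_).norm).pow 2
    · exact continuous_finsetSum _ fun m _ => continuous_finsetSum _ fun i _ =>
        (hgc (S m i)).const_smul (W.sampleImportance T m i)
    · exact continuous_finsetSum _ fun m _ => (continuous_finsetSum (W.mem m t) fun i _ =>
        (hgc (S m i)).const_smul (W.wt m t i / W.localWeight m t)).const_smul (W.aggWeight m t)
  · simp only [gradient_empRisk hℓ, gradient_localRisk hℓ, localGrad]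
    have hgm : ∀ m i, Measurable fun S : W.Dataset Z =>
        gradient (fun θ => ℓ θ (S m i)) (θ : Param d) := fun m i =>
      (hℓ.measurable_gradient hm θ).comp (W.measurable_sample m i)
    refine ((Measurable.sub ?_ ?_).norm).pow_const 2
    · exact Finset.measurable_sum _ fun m _ => Finset.measurable_sum _ fun i _ =>
        (hgm m i).const_smul (W.sampleImportance T m i)
    · exact Finset.measurable_sum _ fun m _ => (Finset.measurable_sum (W.mem m t) fun i _ =>
        (hgm m i).const_smul (W.wt m t i / W.localWeight m t)).const_smul (W.aggWeight m t)

variable {P : Fin M → Measure Z} [∀ m, IsProbabilityMeasure (P m)]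

lemma Weighted.integrable_sqrt_sqGradGap (hW : W.Weighted T) (hℓ : SmoothConvex ℓ L)
    (hm : ∀ θ, Measurable (ℓ θ)) {t : ℕ} (ht : t < T) (hne : Θ.Nonempty) {G : ℝ} (hG0 : 0 ≤ G)
    (hG : ∀ θ ∈ Θ, ∀ z, ‖gradient (fun θ => ℓ θ z) θ‖ ≤ G) :
    Integrable (fun S => Real.sqrt (W.sqGradGap ℓ Θ T t S)) (W.dataLaw P) :=
  integrable_of_abs_le (hW.measurable_sqGradGap hℓ hm ht hne hG0 hG).sqrt
    (b := Real.sqrt ((G + G) ^ 2)) fun S => by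
      rw [abs_of_nonneg (Real.sqrt_nonneg _)]
      exact Real.sqrt_le_sqrt ((le_abs_self _).trans
        (hW.abs_sqGradGap_le hℓ ht hne hG0 hG S))

/-- Jensen for the square root under the product of q and the data law, proved as nonnegativity of a
variance: `c` is the mean of the root gap, and averaging (root gap - c)² gives the mean gap minus
c². -/
lemma Weighted.integral_sqrt_sqGradGap_le (hW : W.Weighted T) (hℓ : SmoothConvex ℓ L)
    (hm : ∀ θ, Measurable (ℓ θ)) (hne : Θ.Nonempty) {G : ℝ} (hG0 : 0 ≤ G)
    (hG : ∀ θ ∈ Θ, ∀ z, ‖gradient (fun θ => ℓ θ z) θ‖ ≤ G) :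
    ∫ S, ∑ t ∈ range T, W.roundImportance T t * Real.sqrt (W.sqGradGap ℓ Θ T t S)
      ∂(W.dataLaw P) ≤ W.gradVariability ℓ Θ P T := by
  set U : W.Dataset Z → ℝ := fun S =>
    ∑ t ∈ range T, W.roundImportance T t * Real.sqrt (W.sqGradGap ℓ Θ T t S) with hU
  set V : W.Dataset Z → ℝ := fun S =>
    ∑ t ∈ range T, W.roundImportance T t * W.sqGradGap ℓ Θ T t S with hV
  have hgap : ∀ t ∈ range T, Integrable
      (fun S => W.roundImportance T t * W.sqGradGap ℓ Θ T t S) (W.dataLaw P) := fun t ht =>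
    (integrable_of_abs_le (hW.measurable_sqGradGap hℓ hm (mem_range.1 ht) hne hG0 hG)
      (hW.abs_sqGradGap_le hℓ (mem_range.1 ht) hne hG0 hG)).const_mul _
  have hUi : Integrable U (W.dataLaw P) := integrable_finsetSum _ fun t ht =>
    (hW.integrable_sqrt_sqGradGap hℓ hm (mem_range.1 ht) hne hG0 hG).const_mul _
  have hVi : Integrable V (W.dataLaw P) := integrable_finsetSum _ hgap
  set c := ∫ S, U S ∂(W.dataLaw P) with hc
  have hpt : ∀ S, 0 ≤ V S - 2 * c * U S + c ^ 2 := by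
    intro S
    have h1 : V S - 2 * c * U S + c ^ 2 = ∑ t ∈ range T,
        W.roundImportance T t * (Real.sqrt (W.sqGradGap ℓ Θ T t S) - c) ^ 2 := by
      have h2 : c ^ 2 = ∑ t ∈ range T, W.roundImportance T t * c ^ 2 := by
        rw [← sum_mul, hW.sum_roundImportance, one_mul]
      rw [h2, hU, hV]
      simp only
      rw [mul_sum, ← sum_sub_distrib, ← sum_add_distrib]
      refine sum_congr rfl fun t _ => ?_
      rw [sub_sq, Real.sq_sqrt (W.sqGradGap_nonneg ℓ Θ T t S)]
      ring
    rw [h1]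
    exact sum_nonneg fun t ht =>
      mul_nonneg (hW.roundImportance_nonneg (mem_range.1 ht)) (sq_nonneg _)
  have hint : 0 ≤ ∫ S, (V S - 2 * c * U S + c ^ 2) ∂(W.dataLaw P) := integral_nonneg hpt
  have hVUi : Integrable (fun S => V S - 2 * c * U S) (W.dataLaw P) := hVi.sub (hUi.const_mul _)
  rw [integral_add hVUi (integrable_const _), integral_sub hVi (hUi.const_mul _),
    integral_const_mul, integral_const] at hint
  simp only [probReal_univ, one_smul] at hint
  rw [gradVariability]
  refine Real.le_sqrt_of_sq_le ?_
  have hVs : ∫ S, V S ∂(W.dataLaw P) =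
      ∑ t ∈ range T, W.roundImportance T t * ∫ S, W.sqGradGap ℓ Θ T t S ∂(W.dataLaw P) := by
    rw [hV, integral_finsetSum _ hgap]
    exact sum_congr rfl fun t _ => integral_const_mul _ _
  rw [hVs] at hint
  simp only [sqGradGap] at hint
  nlinarith

/-! ### The true error -/

/-- Decomposition of the true error into the discrepancy, the optimization error, and the uniform
deviation of the empirical risk. -/
theorem Weighted.trueError_le (hW : W.Weighted T) (hT : 1 ≤ T) (hℓ : SmoothConvex ℓ L)
    (hm : ∀ θ, Measurable (ℓ θ)) {B : ℝ} (hB0 : 0 ≤ B) (hB : ∀ θ ∈ Θ, ∀ z, ℓ θ z ∈ Set.Icc 0 B)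
    (hc : IsClosed Θ) (hconv : Convex ℝ Θ) {D : ℝ} (hD : ∀ x ∈ Θ, ∀ y ∈ Θ, ‖x - y‖ ≤ D)
    {G : ℝ} (hG0 : 0 ≤ G) (hG : ∀ θ ∈ Θ, ∀ z, ‖gradient (fun θ => ℓ θ z) θ‖ ≤ G)
    (hq : ∀ s t, s ≤ t → t < T → W.roundImportance T t ≤ W.roundImportance T s)
    {α : Fin M → ℝ} (hα : ∀ m, 0 ≤ α m) (hα1 : ∑ m, α m = 1)
    {θ₀ : Param d} (hθ₀ : θ₀ ∈ Θ) {η c : ℝ} (hη : 0 < η) (hηc : η ≤ c) {E : ℕ} (hE : 1 ≤ E)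
    {v : ℕ} (hv : hypothesisVCDim ℓ Θ ≤ v) :
    let R := G * ∑ k ∈ range E, (1 + L * c) ^ k
    W.trueError ℓ Θ P α E η θ₀ T ≤
      2 * disc ℓ Θ (mixture P α) (mixture P (W.clientImportance T)) +
        (W.roundImportance T 0 * D ^ 2 / (2 * (η * E)) + D * W.gradVariability ℓ Θ P T +
          η * ((2 * (E * (L * R)) * D + R ^ 2) / (2 * E))) +
        4 * B * (Real.sqrt (v / W.effSamples T) *
          Real.sqrt (1 + Real.posLog (W.numSamples / v))) := by
  intro R
  have hne : Θ.Nonempty := ⟨θ₀, hθ₀⟩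
  have : Nonempty Θ := hne.to_subtype
  have hPα := isProbabilityMeasure_mixture (P := P) hα hα1
  have hPp := isProbabilityMeasure_mixture (P := P) hW.clientImportance_nonneg
    hW.sum_clientImportance
  have hD0 : 0 ≤ D := (norm_nonneg _).trans (hD θ₀ hθ₀ θ₀ hθ₀)
  set Qp := mixture P (W.clientImportance T) with hQp
  set Qα := mixture P α with hQα
  set A := W.output ℓ Θ E η θ₀ T with hA
  set μ := W.dataLaw P with hμ
  set dev : W.Dataset Z → ℝ := fun S => ⨆ θ : Θ, (risk ℓ Qp θ - W.empRisk ℓ T S θ) with hdev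
  set U : W.Dataset Z → ℝ := fun S =>
    ∑ t ∈ range T, W.roundImportance T t * Real.sqrt (W.sqGradGap ℓ Θ T t S) with hU
  set a := W.roundImportance T 0 * D ^ 2 / (2 * (η * E)) with ha
  set b := η * ((2 * (E * (L * R)) * D + R ^ 2) / (2 * E)) with hb
  set δ := disc ℓ Θ Qα Qp with hδ
  have hAmem : ∀ S, A S ∈ Θ := fun S => hW.output_mem hc hconv hθ₀ E η S
  have hdevb : ∀ (θ : Θ) S, |risk ℓ Qp θ - W.empRisk ℓ T S θ| ≤ B := by
    intro θ S
    have h1 := risk_mem_Icc hm (hB θ θ.2) Qp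
    have h2 := hW.empRisk_mem_Icc (hB θ θ.2) S
    rw [abs_le]
    constructor <;> linarith [h1.1, h1.2, h2.1, h2.2]
  have hdevi : Integrable dev μ := by
    refine integrable_of_abs_le (b := B) (measurable_iSup_of_continuous (fun S => ?_)
      (fun θ => ?_) hdevb) fun S => abs_iSup_le fun θ => hdevb θ S
    · exact (hℓ.continuous_risk hm hB _).sub
        ((differentiable_empRisk hℓ W T S).continuous.comp continuous_subtype_val)
    · exact measurable_const.sub (measurable_empRisk hm W T θ)
  have hUi : Integrable U μ := integrable_finsetSum _ fun t ht =>
    (hW.integrable_sqrt_sqGradGap hℓ hm (mem_range.1 ht) hne hG0 hG).const_mul _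
  have hUle : ∫ S, U S ∂μ ≤ W.gradVariability ℓ Θ P T :=
    hW.integral_sqrt_sqGradGap_le hℓ hm hne hG0 hG
  have hdevle := hW.integral_iSup_risk_sub_empRisk_le (P := P) hℓ hm hne hB0 hB hv
  rw [trueError, sub_le_comm]
  -- It suffices to bound the excess over each fixed `w`; no minimizer has to be chosen.
  refine le_ciInf fun w => ?_
  have hLi : Integrable (fun S => W.empRisk ℓ T S w) μ := hW.integrable_empRisk hm (hB w w.2)
  have hpt : ∀ S, risk ℓ Qα (A S) ≤
      W.empRisk ℓ T S w + D * U S + dev S + (a + b + δ) := by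
    intro S
    have h1 := (abs_le.1 (abs_risk_sub_risk_le_disc hm hB Qα Qp (hAmem S))).2
    have h2 : risk ℓ Qp (A S) - W.empRisk ℓ T S (A S) ≤ dev S :=
      le_iSup_of_abs_le (fun θ => hdevb θ S) ⟨A S, hAmem S⟩
    have h3 := hW.optimization_error_le hT hℓ hc hconv hD hG0 hG hq hθ₀ w.2 hη hηc hE S
      (fun t => Real.sqrt (W.sqGradGap ℓ Θ T t S)) fun t ht θ hθ =>
        hW.norm_gradient_sub_le_sqrt hℓ ht hG0 hG S hθ
    simp only at h3
    linarith
  have hLUi : Integrable (fun S => W.empRisk ℓ T S w + D * U S) μ := hLi.add (hUi.const_mul D)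
  have hLUdi : Integrable (fun S => W.empRisk ℓ T S w + D * U S + dev S) μ := hLUi.add hdevi
  have hint : ∫ S, risk ℓ Qα (A S) ∂μ ≤
      ∫ S, (W.empRisk ℓ T S w + D * U S + dev S + (a + b + δ)) ∂μ :=
    -- This form requires integrability of the upper bound only, so measurability of the output in
    -- the dataset is not needed.
    integral_mono_of_nonneg
      (Filter.Eventually.of_forall fun S => (risk_mem_Icc hm (hB _ (hAmem S)) Qα).1)
      (hLUdi.add (integrable_const _))
      (Filter.Eventually.of_forall hpt)
  rw [integral_add hLUdi (integrable_const _), integral_add hLUi hdevi,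
    integral_add hLi (hUi.const_mul D), integral_const_mul, integral_const,
    hW.integral_empRisk hm (hB w w.2)] at hint
  simp only [probReal_univ, one_smul] at hint
  -- Second discrepancy: back from the training mixture to the target at `w`.
  have hwp := (abs_le.1 (abs_risk_sub_risk_le_disc hm hB Qα Qp w.2)).1
  have hDU := mul_le_mul_of_nonneg_left hUle hD0
  linarith

end Stream

end StreamFL

/-! ### Choice of the constant and of the step size -/

theorem theorem3 (B D r c cq : ℝ) (L : NNReal) (E : ℕ) (hr : 0 < r) (hc : 0 < c) (hE : 1 ≤ E) :
    ∃ C : ℝ, 0 ≤ C ∧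
      ∀ (Z : Type*) [MeasurableSpace Z] (d M T : ℕ)
        (ℓ : StreamFL.Param d → Z → ℝ) (Θ : Set (StreamFL.Param d))
        (P : Fin M → MeasureTheory.Measure Z) (α : Fin M → ℝ)
        (W : StreamFL.Stream M) (θ₀ : StreamFL.Param d) (η : ℝ) (v : ℕ),
        -- the clients' distributions and the target mixture weights
        (∀ m, MeasureTheory.IsProbabilityMeasure (P m)) →
        (∀ m, 0 ≤ α m) → ∑ m, α m = 1 →
        -- the loss is measurable in the sample, and bounded on the domain
        (∀ θ, Measurable (ℓ θ)) →
        (∀ θ ∈ Θ, ∀ z, ℓ θ z ∈ Set.Icc 0 B) →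
        -- bounded domain, containing a ball of radius `r`
        IsClosed Θ → Convex ℝ Θ → Bornology.IsBounded Θ → Metric.diam Θ ≤ D →
        (∃ x, Metric.closedBall x r ⊆ Θ) →
        -- convexity and smoothness of the loss
        (∀ z, ConvexOn ℝ Set.univ fun θ => ℓ θ z) →
        (∀ z, Differentiable ℝ fun θ => ℓ θ z) →
        (∀ z, LipschitzWith L (gradient fun θ => ℓ θ z)) →
        -- horizon and sample weights
        1 ≤ T →
        (∀ m, ∀ t < T, ∀ j ∈ W.mem m t, 0 ≤ W.wt m t j) →
        0 < W.totalWeight T →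
        (∀ s t, s ≤ t → t < T → W.roundImportance T t ≤ W.roundImportance T s) →
        W.roundImportance T 0 ≤ cq / T →
        -- initial model, step size, VC dimension
        θ₀ ∈ Θ →
        η = c / (Real.sqrt T * max 1 (W.gradVariability ℓ Θ P T)) →
        StreamFL.hypothesisVCDim ℓ Θ ≤ v →
        W.trueError ℓ Θ P α E η θ₀ T ≤
          C / Real.sqrt T + C * W.gradVariability ℓ Θ P T
            + 2 * StreamFL.disc ℓ Θ (StreamFL.mixture P α)
                (StreamFL.mixture P (W.clientImportance T))
            + C * (Real.sqrt (v / W.effSamples T) *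
                Real.sqrt (1 + Real.posLog (W.numSamples / v))) := by
  obtain ⟨R, hR⟩ : ∃ R, R = (B / r + L * D) * ∑ k ∈ Finset.range E, (1 + L * c) ^ k := ⟨_, rfl⟩
  -- `C₁` comes from the initial distance and `C₂` from the second-order terms. Absolute values are
  -- taken because the signs of `cq`, `D` and `B` are not known before the data are given.
  obtain ⟨C₁, hC₁⟩ : ∃ C₁, C₁ = |cq| * D ^ 2 / (2 * (c * E)) := ⟨_, rfl⟩
  obtain ⟨C₂, hC₂⟩ : ∃ C₂, C₂ = |(2 * (E * (L * R)) * D + R ^ 2) / (2 * E)| := ⟨_, rfl⟩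
  have hE0 : (0 : ℝ) < E := by exact_mod_cast hE
  have hC₁0 : 0 ≤ C₁ := by rw [hC₁]; positivity
  have hC₂0 : 0 ≤ C₂ := by rw [hC₂]; positivity
  refine ⟨C₁ + c * C₂ + |D| + 4 * |B|, by positivity, ?_⟩
  intro Z _ d M T ℓ Θ P α W θ₀ η v hP hα hα1 hm hB hcl hconv hbdd hdiam hball hconvex hdiff hlip
    hT hwt htot hq hcq hθ₀ hη hv
  have hW : W.Weighted T := ⟨hwt, htot⟩
  have hℓ : StreamFL.SmoothConvex ℓ L := ⟨hconvex, hdiff, hlip⟩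
  have hD : ∀ x ∈ Θ, ∀ y ∈ Θ, ‖x - y‖ ≤ D := fun x hx y hy => by
    rw [← dist_eq_norm]
    exact (Metric.dist_le_diam_of_mem hbdd hx hy).trans hdiam
  have hD0 : 0 ≤ D := (norm_nonneg _).trans (hD θ₀ hθ₀ θ₀ hθ₀)
  have hB0 : 0 ≤ B := by
    -- The weights α sum to 1, so a client exists; its probability law makes `Z` nonempty, and a
    -- value of the loss then forces B ≥ 0.
    obtain ⟨m⟩ : Nonempty (Fin M) := by
      by_contra h
      rw [not_nonempty_iff] at h
      simp at hα1
    obtain ⟨z⟩ : Nonempty Z := (P m).nonempty_of_neZero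
    exact (hB θ₀ hθ₀ z).1.trans (hB θ₀ hθ₀ z).2
  set σ := W.gradVariability ℓ Θ P T with hσ
  have hσ0 : 0 ≤ σ := Real.sqrt_nonneg _
  have hT1 : (1 : ℝ) ≤ T := by exact_mod_cast hT
  have hs1 : 1 ≤ Real.sqrt T := Real.one_le_sqrt.2 hT1
  have hs0 : 0 < Real.sqrt T := one_pos.trans_le hs1
  have hx1 : 1 ≤ max 1 σ := le_max_left _ _
  have hx0 : 0 < max 1 σ := one_pos.trans_le hx1
  have hη0 : 0 < η := by rw [hη]; positivity
  have hηs : η ≤ c / Real.sqrt T := by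
    rw [hη]
    exact div_le_div_of_nonneg_left hc.le hs0 (le_mul_of_one_le_right hs0.le hx1)
  have hηc : η ≤ c := hηs.trans (div_le_self hc.le hs1)
  have hmain := hW.trueError_le (P := P) hT hℓ hm hB0 hB hcl hconv hD
    (G := B / r + L * D) (by positivity)
    (fun θ hθ z => hℓ.norm_gradient_le hr hB hD hball hθ z) hq hα hα1 hθ₀ hη0 hηc hE hv
  simp only [← hR] at hmain
  -- The factor 1/T of q^(1) against 1/η = √T max(1, σ)/c leaves max(1, σ)/√T, and max(1, σ) ≤ 1 +
  -- σ.
  have h1 : W.roundImportance T 0 * D ^ 2 / (2 * (η * E)) ≤ C₁ / Real.sqrt T + C₁ * σ := by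
    calc W.roundImportance T 0 * D ^ 2 / (2 * (η * E))
        ≤ |cq| / T * D ^ 2 / (2 * (η * E)) := by
          gcongr
          exact hcq.trans (by gcongr; exact le_abs_self cq)
      _ = C₁ * max 1 σ / Real.sqrt T := by
          rw [hC₁, hη]
          nth_rewrite 1 [← Real.sq_sqrt (Nat.cast_nonneg T)]
          field_simp
      _ ≤ C₁ * (1 + σ) / Real.sqrt T := by
          gcongr
          exact max_le (by linarith) (by linarith)
      _ = C₁ / Real.sqrt T + C₁ * σ / Real.sqrt T := by ring
      _ ≤ C₁ / Real.sqrt T + C₁ * σ := by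
          gcongr
          exact div_le_self (by positivity) hs1
  have h2 : η * ((2 * (E * (L * R)) * D + R ^ 2) / (2 * E)) ≤ c * C₂ / Real.sqrt T := by
    calc η * ((2 * (E * (L * R)) * D + R ^ 2) / (2 * E)) ≤ c / Real.sqrt T * C₂ := by
          rw [hC₂]
          exact (mul_le_mul_of_nonneg_left (le_abs_self _) hη0.le).trans
            (mul_le_mul_of_nonneg_right hηs (abs_nonneg _))
      _ = c * C₂ / Real.sqrt T := by ring
  rw [abs_of_nonneg hD0, abs_of_nonneg hB0]
  set Q := Real.sqrt (v / W.effSamples T) * Real.sqrt (1 + Real.posLog (W.numSamples / v)) with hQ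
  have hQ0 : 0 ≤ Q := by positivity
  -- One constant serves all three terms; the surplus in each is nonnegative and is dropped.
  have e1 : (C₁ + c * C₂ + D + 4 * B) / Real.sqrt T =
      C₁ / Real.sqrt T + c * C₂ / Real.sqrt T + (D + 4 * B) / Real.sqrt T := by ring
  have e2 : 0 ≤ (D + 4 * B) / Real.sqrt T := by positivity
  have e3 : 0 ≤ (c * C₂ + 4 * B) * σ := by positivity
  have e4 : 0 ≤ (C₁ + c * C₂ + D) * Q := by positivity
  rw [e1]
  linarith
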